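/- Let $n\ge 2$ and let $\Omega\subset\mathbb R^n$ be a bounded domain with smooth boundary. Let $u\in C^\infty(\overline\Omega)$ satisfy $|Du|<1$ on $\overline\Omega$ and $u=c$ on $\partial\Omega$ for a constant $c$; put $w=\sqrt{1-|Du|^2}$. Let $M=\{(x,u(x))\}$ be the corresponding space-like graph in Minkowski space $\mathbb R^{n,1}$ (metric $\sum_{i\le n} dx_i^2-dx_{n+1}^2$), with upward unit normal $e=\frac1w(Du,1)$, induced metric $g_{ij}=\delta_{ij}-u_iu_j$, second fundamental form $h_{ij}=u_{ij}/w$, shape operator $h_i^j=g^{jk}h_{ik}$, mean curvature $H=\sum_i h_i^i$, and trace-free second fundamental form $\bar h_i^j=h_i^j-\frac1nH\delta_i^j$, with $|\bar h|^2=\sum_{i,j}\bar h_i^j\bar h_j^i$. Assume that the mean curvature of $M$ is constant, normalised to $H=n$. Let $H_{\partial\Omega}$ be the mean curvature of $\partial\Omega$ (the average of its $n-1$ principal curvatures, positive for balls), and assume $H_{\partial\Omega}\ge\underline H$ on $\partial\Omega$ for a constant $\underline H>0$. Let $\theta=\langle e,E_{n+1}\rangle=-1/w$ on $\partial\Omega$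 be the angle function, where $E_{n+1}=(0,\dots,0,1)$, let $d\sigma$ be the surface measure of $\partial\Omega$, and let $H_0=\frac{|\partial\Omega|}{n|\Omega|}$. Then $\operatorname{div}(Du/w)=n$ in $\Omega$, the quantities below are well defined and finite, $\int_{\partial\Omega}\frac{1}{H_{\partial\Omega}}\,d\sigma\ge n|\Omega|$, and each of the following three estimates holds, where $L^2(\Omega)$ is taken with respect to Lebesgue measure $dx$: (a) $\displaystyle \|\bar h\|_{L^2(\Omega)}\le\Big((n-1)\Big(\int_{\partial\Omega}\frac{1}{H_{\partial\Omega}}\,d\sigma-n|\Omega|\Big)\Big)^{1/2}$; (b) $\displaystyle \|\bar h\|_{L^2(\Omega)}\le\sqrt{n-1}\,\Big\|\frac1{H_{\partial\Omega}}-\sqrt{\theta^2-1}\Big\|_{L^1(\partial\Omega)}^{1/2}$; (c) $\displaystyle \|\bar h\|_{L^2(\Omega)}\le\sqrt{\frac{n(n-1)|\Omega|}{\underline H}}\;\|H_0-H_{\partial\Omega}\|_{L^\infty(\partial\Omega)}^{1/2}$. -/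

import Mathlib

open MeasureTheory
open scoped ContDiff Topology

noncomputable section

/-- Minkowski space `ℝ^{n,1}`, written as `ℝⁿ × ℝ` (the last coordinate is time-like). -/
abbrev MinkowskiSpace (n : ℕ) : Type := EuclideanSpace ℝ (Fin n) × ℝ

/-- The Lorentzian inner product `x₁y₁ + ⋯ + xₙyₙ - xₙ₊₁yₙ₊₁`. -/
def lorentz {n : ℕ} (X Y : MinkowskiSpace n) : ℝ := inner ℝ X.1 Y.1 - X.2 * Y.2

/-! ### Domains with smooth boundary and the mean curvature of the boundary -/

/-- `ρ` is a smooth defining function of `Ω` near the boundary point `x`: close to `x` the set `Ω`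
is `{ρ < 0}`, and the gradient of `ρ` does not vanish at `x` (hence it points out of `Ω`). -/
def IsLocalDefiningFunction {n : ℕ} (Ω : Set (EuclideanSpace ℝ (Fin n)))
    (x : EuclideanSpace ℝ (Fin n)) (ρ : EuclideanSpace ℝ (Fin n) → ℝ) : Prop :=
  ContDiff ℝ ∞ ρ ∧ gradient ρ x ≠ 0 ∧ ∀ᶠ y in 𝓝 x, (y ∈ Ω ↔ ρ y < 0)

/-- The boundary of `Ω` is a smooth hypersurface, with `Ω` locally on one side of it. -/
def HasSmoothBoundary {n : ℕ} (Ω : Set (EuclideanSpace ℝ (Fin n))) : Prop :=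
  ∀ x ∈ frontier Ω, ∃ ρ, IsLocalDefiningFunction Ω x ρ

/-- Mean curvature (the average of the `n - 1` principal curvatures) at `x` of the level set of `ρ`
through `x`, with respect to the unit normal `N = ∇ρ / |∇ρ|`. The second fundamental form is
`D²ρ / |∇ρ|` restricted to the tangent space `N^⊥`; the trace over `N^⊥` is the full trace
minus the value on `(N, N)`. For `ρ = |x|² - R²` and `|x| = R` this is `1 / R`. -/
def levelSetMeanCurvature {n : ℕ} (ρ : EuclideanSpace ℝ (Fin n) → ℝ)
    (x : EuclideanSpace ℝ (Fin n)) : ℝ :=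
  let N : EuclideanSpace ℝ (Fin n) := ‖gradient ρ x‖⁻¹ • gradient ρ x
  ((∑ i : Fin n, fderiv ℝ (fderiv ℝ ρ) x (EuclideanSpace.single i 1) (EuclideanSpace.single i 1))
      - fderiv ℝ (fderiv ℝ ρ) x N N) / (((n : ℝ) - 1) * ‖gradient ρ x‖)

open Classical in
/-- The mean curvature `H_{∂Ω}` of the boundary of `Ω` at the boundary point `x`, normalised as the
average of the principal curvatures and positive for balls. It is computed from any smooth local
defining function (all of them give the same value); elsewhere it is set to `0`. -/
def boundaryMeanCurvature {n : ℕ} (Ω : Set (EuclideanSpace ℝ (Fin n)))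
    (x : EuclideanSpace ℝ (Fin n)) : ℝ :=
  if h : ∃ ρ, IsLocalDefiningFunction Ω x ρ then levelSetMeanCurvature h.choose x else 0

/-- The surface measure of `∂Ω`: the `(n-1)`-dimensional Hausdorff measure, normalised to agree
with Lebesgue measure on `ℝ^{n-1}`, restricted to the boundary. -/
def surfaceMeasure {n : ℕ} (Ω : Set (EuclideanSpace ℝ (Fin n))) :
    Measure (EuclideanSpace ℝ (Fin n)) :=
  (Measure.euclideanHausdorffMeasure (n - 1)).restrict (frontier Ω)

/-! ### The space-like graph of a function on `closure Ω` -/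

/-- The gradient `Du`, up to the boundary of `Ω` (in `Ω` it is the usual gradient). -/
def graphGradient {n : ℕ} (Ω : Set (EuclideanSpace ℝ (Fin n))) (u : EuclideanSpace ℝ (Fin n) → ℝ)
    (x : EuclideanSpace ℝ (Fin n)) : EuclideanSpace ℝ (Fin n) :=
  gradientWithin u (closure Ω) x

/-- `w = √(1 - |Du|²)`. -/
def graphW {n : ℕ} (Ω : Set (EuclideanSpace ℝ (Fin n))) (u : EuclideanSpace ℝ (Fin n) → ℝ)
    (x : EuclideanSpace ℝ (Fin n)) : ℝ :=
  √(1 - ‖graphGradient Ω u x‖ ^ 2)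

/-- The coordinate tangent vectors `φᵢ = Eᵢ + uᵢ Eₙ₊₁` of the graph. -/
def graphTangent {n : ℕ} (Ω : Set (EuclideanSpace ℝ (Fin n))) (u : EuclideanSpace ℝ (Fin n) → ℝ)
    (x : EuclideanSpace ℝ (Fin n)) (i : Fin n) : MinkowskiSpace n :=
  (EuclideanSpace.single i 1, graphGradient Ω u x i)

/-- The upward time-like unit normal `(Du, 1) / w` of the graph. -/
def graphNormal {n : ℕ} (Ω : Set (EuclideanSpace ℝ (Fin n))) (u : EuclideanSpace ℝ (Fin n) → ℝ)
    (x : EuclideanSpace ℝ (Fin n)) : MinkowskiSpace n :=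
  (graphW Ω u x)⁻¹ • (graphGradient Ω u x, 1)

/-- The induced metric `gᵢⱼ = ⟨φᵢ, φⱼ⟩`. -/
def graphMetric {n : ℕ} (Ω : Set (EuclideanSpace ℝ (Fin n))) (u : EuclideanSpace ℝ (Fin n) → ℝ)
    (x : EuclideanSpace ℝ (Fin n)) : Matrix (Fin n) (Fin n) ℝ :=
  Matrix.of fun i j => lorentz (graphTangent Ω u x i) (graphTangent Ω u x j)

/-- The second fundamental form `hᵢⱼ = ⟨φᵢ, ∂ⱼ e⟩`, where `e` is the upward unit normal. -/
def graphSecondForm {n : ℕ} (Ω : Set (EuclideanSpace ℝ (Fin n)))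
    (u : EuclideanSpace ℝ (Fin n) → ℝ) (x : EuclideanSpace ℝ (Fin n)) :
    Matrix (Fin n) (Fin n) ℝ :=
  Matrix.of fun i j => lorentz (graphTangent Ω u x i)
    (fderiv ℝ (graphNormal Ω u) x (EuclideanSpace.single j 1))

/-- The shape operator `g⁻¹ h`. -/
def shapeOperator {n : ℕ} (Ω : Set (EuclideanSpace ℝ (Fin n)))
    (u : EuclideanSpace ℝ (Fin n) → ℝ) (x : EuclideanSpace ℝ (Fin n)) :
    Matrix (Fin n) (Fin n) ℝ :=
  (graphMetric Ω u x)⁻¹ * graphSecondForm Ω u x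

/-- The mean curvature of the graph: the sum of its principal curvatures. -/
def graphMeanCurvature {n : ℕ} (Ω : Set (EuclideanSpace ℝ (Fin n)))
    (u : EuclideanSpace ℝ (Fin n) → ℝ) (x : EuclideanSpace ℝ (Fin n)) : ℝ :=
  (shapeOperator Ω u x).trace

/-- The trace-free second fundamental form (as an endomorphism) `A - (H / n) I`. -/
def traceFreeShape {n : ℕ} (Ω : Set (EuclideanSpace ℝ (Fin n)))
    (u : EuclideanSpace ℝ (Fin n) → ℝ) (x : EuclideanSpace ℝ (Fin n)) :
    Matrix (Fin n) (Fin n) ℝ :=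
  shapeOperator Ω u x - (graphMeanCurvature Ω u x / n) • (1 : Matrix (Fin n) (Fin n) ℝ)

/-- The norm, in the induced metric, of the trace-free second fundamental form. Its square is the
full contraction of the endomorphism with itself, that is, the trace of its square. -/
def traceFreeNorm {n : ℕ} (Ω : Set (EuclideanSpace ℝ (Fin n)))
    (u : EuclideanSpace ℝ (Fin n) → ℝ) (x : EuclideanSpace ℝ (Fin n)) : ℝ :=
  √(traceFreeShape Ω u x * traceFreeShape Ω u x).trace

/-- The angle function `θ = ⟨e, Eₙ₊₁⟩`: the product of the upward unit normals of the graph and of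
the horizontal hyperplane. -/
def angleFunction {n : ℕ} (Ω : Set (EuclideanSpace ℝ (Fin n)))
    (u : EuclideanSpace ℝ (Fin n) → ℝ) (x : EuclideanSpace ℝ (Fin n)) : ℝ :=
  lorentz (graphNormal Ω u x) (0, 1)

/-- The reference constant `H₀ = |∂Ω| / (n |Ω|)`. -/
def referenceCurvature {n : ℕ} (Ω : Set (EuclideanSpace ℝ (Fin n))) : ℝ :=
  (surfaceMeasure Ω).real Set.univ / (n * volume.real Ω)

end

/-! Everything is read off from the vector field `V = Du / w`. Its Jacobian is the shape operator of
the graph (`shapeOperator_eq_jacobian`), so `H = n` says `div V = n`, and `|h̄|² = tr((DV)²) - n`.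
Since `div V` is constant, `tr((DV)²) = div(D_V V)` (`divergence_convective_derivative`), which
turns the `L²` norm of `h̄` into a boundary integral.

On `∂Ω` the function `u` is constant, so `V = φ ν` with `ν` the outer normal. The tangential part of
`div V` there is `(n - 1) H_{∂Ω} φ`, whence `⟨D_V V, ν⟩ = n φ - (n - 1) H_{∂Ω} φ²`
(`inner_convective_derivative`). Together with `∫ φ = n|Ω|` this gives the identity `∫_Ω |h̄|² = (n
- 1) D`, where `D = ∫ φ - ∫ H_{∂Ω} φ²` (`integral_traceFreeNorm_sq`).

The estimates are three bounds for `D`. Completing a square gives `φ - H φ² ≤ 1/H - |φ|`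
(`sub_mul_sq_le`). Since `|φ| = √(θ² - 1)` on `∂Ω`, this yields (a) and (b); with `D ≥ 0` it also
yields `∫ 1/H_{∂Ω} ≥ n|Ω|`. For (c), Cauchy–Schwarz and the choice of `H₀` give `∫ φ ≤ H₀ ∫ φ²`, so
`D ≤ ∫ (H₀ - H_{∂Ω}) φ²`, while `D ≥ 0` bounds `∫ φ²` by `n|Ω| / H̲`.

The divergence theorem for the Hausdorff surface measure is proved directly
(`integral_divergence_eq`). Near a boundary point, integrating along normal lines expresses the
normal flux of `g` as an integral over the tangent plane. Orthogonal projection of the boundary to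
that plane is almost isometric, so Hausdorff and Lebesgue measure almost agree. A partition of unity
sums these local statements with total error at most `ε ∫ g dσ` for every `ε > 0`. -/

namespace SpacelikeGraph
open Set Filter

/-! ### Fubini along lines in the direction of a basis vector -/

section LineCoordinates

variable {E : Type*} [NormedAddCommGroup E] [InnerProductSpace ℝ E] {m : ℕ}

/-- The coordinates of `x` other than the zeroth one. -/
noncomputable def dropZero (b : OrthonormalBasis (Fin (m + 1)) ℝ E) (x : E) :
    EuclideanSpace ℝ (Fin m) :=
  WithLp.toLp 2 fun i => b.repr x i.succ

/-- The point with zeroth coordinate `t` and other coordinates `y`. -/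
noncomputable def lineMap (b : OrthonormalBasis (Fin (m + 1)) ℝ E)
    (y : EuclideanSpace ℝ (Fin m)) (t : ℝ) : E :=
  b.repr.symm (WithLp.toLp 2 (Fin.cons t y.ofLp))

variable (b : OrthonormalBasis (Fin (m + 1)) ℝ E)

lemma lineMap_dropZero (x : E) : lineMap b (dropZero b x) (b.repr x 0) = x := by
  rw [lineMap, LinearIsometryEquiv.symm_apply_eq]
  ext i
  refine Fin.cases ?_ (fun j => ?_) i <;> simp [dropZero]

lemma dropZero_lineMap (y : EuclideanSpace ℝ (Fin m)) (t : ℝ) : dropZero b (lineMap b y t) = y := by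
  ext i
  simp [dropZero, lineMap]

lemma lineMap_add (y : EuclideanSpace ℝ (Fin m)) (s t : ℝ) :
    lineMap b y (s + t) = lineMap b y s + t • b 0 := by
  apply b.repr.injective
  ext i
  refine Fin.cases ?_ (fun j => ?_) i <;> simp [lineMap]

lemma lineMap_dropZero_add (x : E) (t : ℝ) :
    lineMap b (dropZero b x) (b.repr x 0 + t) = x + t • b 0 := by
  rw [lineMap_add, lineMap_dropZero]

lemma norm_sq_eq_inner_sq_add (x : E) :
    ‖x‖ ^ 2 = inner ℝ (b 0) x ^ 2 + ‖dropZero b x‖ ^ 2 := by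
  rw [← b.repr.norm_map x, EuclideanSpace.norm_sq_eq, EuclideanSpace.norm_sq_eq, Fin.sum_univ_succ]
  simp [dropZero, b.repr_apply_apply]

lemma dropZero_sub (x y : E) : dropZero b (x - y) = dropZero b x - dropZero b y := by
  ext i
  simp [dropZero]

lemma norm_dropZero_le (x : E) : ‖dropZero b x‖ ≤ ‖x‖ := by
  have := norm_sq_eq_inner_sq_add b x
  exact abs_le_of_sq_le_sq' (by nlinarith [sq_nonneg (inner ℝ (b 0) x)]) (norm_nonneg _) |>.2

lemma lipschitzWith_dropZero : LipschitzWith 1 (dropZero b) := by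
  refine LipschitzWith.of_dist_le_mul fun x y => ?_
  rw [dist_eq_norm, dist_eq_norm, ← dropZero_sub]
  simpa using norm_dropZero_le b (x - y)

lemma exists_orthonormalBasis_zero [FiniteDimensional ℝ E] (hfr : Module.finrank ℝ E = m + 1)
    {e : E} (he : ‖e‖ = 1) :
    ∃ b : OrthonormalBasis (Fin (m + 1)) ℝ E, b 0 = e := by
  obtain ⟨b, hb⟩ := Orthonormal.exists_orthonormalBasis_extension_of_card_eq (𝕜 := ℝ)
    (ι := Fin (m + 1)) (by simpa using hfr) (v := fun _ => e) (s := {0}) (by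
      constructor
      · rintro ⟨i, hi⟩
        simpa using he
      · rintro ⟨i, hi⟩ ⟨j, hj⟩ hij
        exact absurd (Subtype.ext (hi.trans hj.symm)) hij)
  exact ⟨b, hb 0 rfl⟩

variable [FiniteDimensional ℝ E] [MeasurableSpace E] [BorelSpace E]

lemma measurePreserving_lineMap :
    MeasurePreserving (fun p : ℝ × EuclideanSpace ℝ (Fin m) => lineMap b p.2 p.1) := by
  have h1 : MeasurePreserving (fun p : ℝ × EuclideanSpace ℝ (Fin m) => (p.1, p.2.ofLp)) :=
    (MeasurePreserving.id volume).prod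
      (EuclideanSpace.volume_preserving_symm_measurableEquiv_toLp (Fin m))
  have h2 := (volume_preserving_piFinSuccAbove (fun _ : Fin (m + 1) => ℝ) 0).symm
  have h3 := b.measurePreserving_repr_symm.comp
    ((PiLp.volume_preserving_toLp (Fin (m + 1))).comp (h2.comp h1))
  have h4 : (fun p : ℝ × EuclideanSpace ℝ (Fin m) => lineMap b p.2 p.1) =
      b.repr.symm ∘ WithLp.toLp 2 ∘ (MeasurableEquiv.piFinSuccAbove (fun _ => ℝ) 0).symm ∘
        fun p : ℝ × EuclideanSpace ℝ (Fin m) => (p.1, p.2.ofLp) := by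
    funext p
    simp [lineMap, MeasurableEquiv.piFinSuccAbove, Fin.insertNthEquiv]
  rw [h4]
  exact h3

lemma integral_eq_integral_lineMap {F : E → ℝ} (hF : Integrable F) :
    ∫ x, F x = ∫ y : EuclideanSpace ℝ (Fin m), ∫ t : ℝ, F (lineMap b y t) := by
  have hmp := measurePreserving_lineMap b
  have hmap : ∫ x, F x = ∫ p : ℝ × EuclideanSpace ℝ (Fin m), F (lineMap b p.2 p.1) := by
    conv_lhs => rw [← hmp.map_eq]
    refine integral_map hmp.measurable.aemeasurable ?_
    rw [hmp.map_eq]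
    exact hF.aestronglyMeasurable
  rw [hmap]
  exact integral_prod_symm _ (hmp.integrable_comp_of_integrable hF)

lemma integrable_integral_lineMap {F : E → ℝ} (hF : Integrable F) :
    Integrable fun y : EuclideanSpace ℝ (Fin m) => ∫ t : ℝ, F (lineMap b y t) :=
  ((measurePreserving_lineMap b).integrable_comp_of_integrable hF).integral_prod_right

end LineCoordinates

/-! ### The fundamental theorem of calculus along lines crossing the boundary -/

section LineIntegrals

variable {E : Type*} [NormedAddCommGroup E] [InnerProductSpace ℝ E]

/-- Inside `B`, lines in direction `e` leave `Ω` where they meet its boundary. -/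
def IsTransversal (Ω B : Set E) (e : E) : Prop :=
  ∀ p ∈ frontier Ω ∩ B, ∀ s : ℝ, p + s • e ∈ B → (s < 0 → p + s • e ∈ Ω) ∧ (0 < s → p + s • e ∉ Ω)

/-- `g` is a test function for the divergence theorem in `B`: it is continuous on `closure Ω`,
differentiable in `Ω` with bounded derivative, and vanishes outside of `B`. -/
structure IsTestFunction (Ω B : Set E) (g : E → ℝ) : Prop where
  continuousOn : ContinuousOn g (closure Ω)
  differentiableOn : DifferentiableOn ℝ g Ω
  bounded : ∃ C, ∀ x ∈ Ω, ‖fderiv ℝ g x‖ ≤ C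
  tsupport_subset : tsupport g ⊆ B

/-- The derivative of `g` in direction `e`, extended by zero. -/
noncomputable def dirDeriv (Ω : Set E) (g : E → ℝ) (e : E) : E → ℝ :=
  Ω.indicator fun x => fderiv ℝ g x e

variable {Ω B : Set E} {g : E → ℝ} {e : E}

lemma dirDeriv_eq_zero_of_notMem_tsupport {x : E} (hx : x ∉ tsupport g) :
    dirDeriv Ω g e x = 0 := by
  have : fderiv ℝ g x = 0 := by
    have h : g =ᶠ[𝓝 x] fun _ => 0 := notMem_tsupport_iff_eventuallyEq.mp hx
    rw [h.fderiv_eq]; simp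
  simp [dirDeriv, indicator, this]

lemma hasDerivAt_line (x v : E) (t : ℝ) : HasDerivAt (fun t : ℝ => x + t • v) v t := by
  simpa using ((hasDerivAt_id t).smul_const v).const_add x

lemma IsTestFunction.norm_dirDeriv_le (hg : IsTestFunction Ω B g) (e : E) :
    ∃ C, ∀ x, ‖dirDeriv Ω g e x‖ ≤ C := by
  obtain ⟨C, hC⟩ := hg.bounded
  refine ⟨max C 0 * ‖e‖, fun x => ?_⟩
  by_cases hx : x ∈ Ω
  · rw [dirDeriv, indicator_of_mem hx]
    exact (ContinuousLinearMap.le_opNorm _ _).trans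
      (mul_le_mul_of_nonneg_right ((hC x hx).trans (le_max_left _ _)) (norm_nonneg _))
  · rw [dirDeriv, indicator_of_notMem hx, norm_zero]; positivity

lemma exists_bound_of_line_mem (hB : Bornology.IsBounded B) (he : e ≠ 0) (x : E) :
    ∃ R : ℝ, ∀ t : ℝ, x + t • e ∈ B → |t| ≤ R := by
  obtain ⟨C, hC⟩ := hB.exists_norm_le
  refine ⟨(C + ‖x‖) / ‖e‖, fun t ht => ?_⟩
  rw [le_div_iff₀ (norm_pos_iff.mpr he), ← Real.norm_eq_abs, ← norm_smul]
  calc ‖t • e‖ = ‖(x + t • e) - x‖ := by simp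
    _ ≤ ‖x + t • e‖ + ‖x‖ := norm_sub_le _ _
    _ ≤ C + ‖x‖ := by gcongr; exact hC _ ht

lemma IsTestFunction.line_eventually_zero (hg : IsTestFunction Ω B g)
    (hB : Bornology.IsBounded B) (he : e ≠ 0) (x : E) (s : Set E) :
    Tendsto (fun t : ℝ => s.indicator g (x + t • e)) atBot (𝓝 0) ∧
      Tendsto (fun t : ℝ => s.indicator g (x + t • e)) atTop (𝓝 0) := by
  obtain ⟨R, hR⟩ := exists_bound_of_line_mem hB he x
  have h0 : ∀ t : ℝ, R < |t| → s.indicator g (x + t • e) = 0 := by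
    intro t ht
    have : g (x + t • e) = 0 := image_eq_zero_of_notMem_tsupport fun h =>
      not_le.mpr ht (hR t (hg.tsupport_subset h))
    simp [indicator, this]
  constructor
  · refine tendsto_const_nhds.congr' ?_
    filter_upwards [eventually_lt_atBot (-R)] with t ht
    exact (h0 t (by linarith [neg_le_abs t])).symm
  · refine tendsto_const_nhds.congr' ?_
    filter_upwards [eventually_gt_atTop R] with t ht
    exact (h0 t (ht.trans_le (le_abs_self t))).symm

variable [MeasurableSpace E] [BorelSpace E]

lemma measurable_dirDeriv (hΩ : IsOpen Ω) [FiniteDimensional ℝ E] : Measurable (dirDeriv Ω g e) :=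
  (measurable_fderiv_apply_const ℝ g e).indicator hΩ.measurableSet

lemma IsTestFunction.integrable_line [FiniteDimensional ℝ E] (hg : IsTestFunction Ω B g)
    (hΩ : IsOpen Ω) (hB : Bornology.IsBounded B) (he : e ≠ 0) (x : E) :
    Integrable fun t : ℝ => dirDeriv Ω g e (x + t • e) := by
  obtain ⟨R, hR⟩ := exists_bound_of_line_mem hB he x
  obtain ⟨C, hC⟩ := hg.norm_dirDeriv_le e
  have hm : Measurable fun t : ℝ => dirDeriv Ω g e (x + t • e) :=
    (measurable_dirDeriv hΩ).comp (by fun_prop)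
  have hsupp : (Icc (-R) R).indicator (fun t : ℝ => dirDeriv Ω g e (x + t • e)) =
      fun t : ℝ => dirDeriv Ω g e (x + t • e) := by
    refine indicator_eq_self.mpr fun t ht => abs_le.mp (hR t ?_)
    by_contra hxt
    exact ht (dirDeriv_eq_zero_of_notMem_tsupport fun h => hxt (hg.tsupport_subset h))
  rw [← hsupp, integrable_indicator_iff measurableSet_Icc]
  exact Measure.integrableOn_of_bounded (by simp) hm.aestronglyMeasurable
    (Eventually.of_forall fun t => hC _)

/-- A line which meets the boundary of `Ω` in `B` at `p`. -/
lemma IsTestFunction.integral_line_eq [FiniteDimensional ℝ E] (hg : IsTestFunction Ω B g)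
    (hΩ : IsOpen Ω) (hBo : IsOpen B) (hB : Bornology.IsBounded B) (he : e ≠ 0)
    (hT : IsTransversal Ω B e) {p : E} (hp : p ∈ frontier Ω ∩ B) :
    ∫ t : ℝ, dirDeriv Ω g e (p + t • e) = g p := by
  -- Past `p` the line is either outside `Ω`, by transversality, or outside `B`, where `g` vanishes;
  -- only the half-line ending at `p` contributes.
  have hsplit : (Iic (0 : ℝ)).indicator (fun t : ℝ => dirDeriv Ω g e (p + t • e)) =
      fun t : ℝ => dirDeriv Ω g e (p + t • e) := by
    refine indicator_eq_self.mpr fun t ht => ?_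
    by_contra ht0
    rw [mem_Iic, not_le] at ht0
    by_cases hB' : p + t • e ∈ B
    · exact ht (indicator_of_notMem ((hT p hp t hB').2 ht0) _)
    · exact ht (dirDeriv_eq_zero_of_notMem_tsupport fun h => hB' (hg.tsupport_subset h))
  rw [← hsplit, integral_indicator measurableSet_Iic]
  have hlim := (hg.line_eventually_zero hB he p univ).1
  simp only [indicator_univ] at hlim
  have hcl : p + (0 : ℝ) • e ∈ closure Ω := by simpa using frontier_subset_closure hp.1
  rw [integral_Iic_of_hasDerivAt_of_tendsto (f := fun t : ℝ => g (p + t • e)) ?_ ?_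
    (hg.integrable_line hΩ hB he p).integrableOn hlim]
  · simp
  · have hcont : ContinuousAt (fun t : ℝ => p + t • e) 0 := by fun_prop
    have hBn : ∀ᶠ t : ℝ in 𝓝[Iic 0] 0, p + t • e ∈ B :=
      nhdsWithin_le_nhds (hcont.eventually (by simpa using hBo.mem_nhds hp.2))
    have hmem : ∀ᶠ t : ℝ in 𝓝[Iic 0] 0, p + t • e ∈ closure Ω := by
      filter_upwards [hBn, self_mem_nhdsWithin] with t ht ht0
      rcases (mem_Iic.mp ht0).lt_or_eq with h | rfl
      · exact subset_closure ((hT p hp t ht).1 h)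
      · exact hcl
    exact Tendsto.comp (hg.continuousOn _ hcl)
      (tendsto_nhdsWithin_iff.mpr ⟨hcont.tendsto.mono_left nhdsWithin_le_nhds, hmem⟩)
  · intro t ht
    by_cases hB' : p + t • e ∈ tsupport g
    · have hmem : p + t • e ∈ Ω := (hT p hp t (hg.tsupport_subset hB')).1 ht
      rw [dirDeriv, indicator_of_mem hmem]
      exact ((hg.differentiableOn _ hmem).differentiableAt
        (hΩ.mem_nhds hmem)).hasFDerivAt.comp_hasDerivAt t (hasDerivAt_line p e t)
    · rw [dirDeriv_eq_zero_of_notMem_tsupport hB']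
      have h0 : (fun t : ℝ => g (p + t • e)) =ᶠ[𝓝 t] fun _ => 0 :=
        (show ContinuousAt (fun t : ℝ => p + t • e) t by fun_prop).eventually
          (notMem_tsupport_iff_eventuallyEq.mp hB')
      exact (hasDerivAt_const t (0 : ℝ)).congr_of_eventuallyEq h0

/-- A line which does not meet the boundary of `Ω` in `B`. -/
lemma IsTestFunction.integral_line_eq_zero [FiniteDimensional ℝ E] (hg : IsTestFunction Ω B g)
    (hΩ : IsOpen Ω) (hB : Bornology.IsBounded B) (he : e ≠ 0) {x : E}
    (hx : ∀ t : ℝ, x + t • e ∉ frontier Ω ∩ B) :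
    ∫ t : ℝ, dirDeriv Ω g e (x + t • e) = 0 := by
  have hlim := hg.line_eventually_zero hB he x Ω
  -- With no boundary point in `B` on the line, the extension of `g` by zero outside `Ω` is
  -- differentiable along the whole line.
  rw [integral_of_hasDerivAt_of_tendsto (f := fun t : ℝ => Ω.indicator g (x + t • e)) ?_
    (hg.integrable_line hΩ hB he x) hlim.1 hlim.2, sub_zero]
  intro t
  have hcont : ContinuousAt (fun t : ℝ => x + t • e) t := by fun_prop
  by_cases hB' : x + t • e ∈ tsupport g
  · by_cases hmem : x + t • e ∈ Ω
    · rw [dirDeriv, indicator_of_mem hmem]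
      refine (((hg.differentiableOn _ hmem).differentiableAt
        (hΩ.mem_nhds hmem)).hasFDerivAt.comp_hasDerivAt t
          (hasDerivAt_line x e t)).congr_of_eventuallyEq ?_
      filter_upwards [hcont.eventually (hΩ.mem_nhds hmem)] with s hs
      exact indicator_of_mem hs g
    · have hcl : x + t • e ∉ closure Ω := fun h =>
        hx t ⟨by rw [hΩ.frontier_eq]; exact ⟨h, hmem⟩, hg.tsupport_subset hB'⟩
      rw [dirDeriv, indicator_of_notMem hmem]
      refine (hasDerivAt_const t (0 : ℝ)).congr_of_eventuallyEq ?_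
      filter_upwards [hcont.eventually (isClosed_closure.isOpen_compl.mem_nhds hcl)] with s hs
      exact indicator_of_notMem (fun h => hs (subset_closure h)) g
  · rw [dirDeriv_eq_zero_of_notMem_tsupport hB']
    refine (hasDerivAt_const t (0 : ℝ)).congr_of_eventuallyEq ?_
    filter_upwards [hcont.eventually (notMem_tsupport_iff_eventuallyEq.mp hB')] with s hs
    simp only [indicator, hs]; simp

end LineIntegrals

/-! ### Hausdorff measure under projection to a hyperplane -/

section HausdorffMeasure

lemma lipschitzOnWith_euclideanHausdorffMeasure_image_le {X Y : Type*} [EMetricSpace X]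
    [MeasurableSpace X] [BorelSpace X] [EMetricSpace Y] [MeasurableSpace Y] [BorelSpace Y]
    {K : NNReal} {f : X → Y} {s : Set X} (h : LipschitzOnWith K f s) (d : ℕ) :
    Measure.euclideanHausdorffMeasure d (f '' s) ≤
      K ^ d * Measure.euclideanHausdorffMeasure d s := by
  rw [Measure.euclideanHausdorffMeasure_def, Measure.euclideanHausdorffMeasure_def,
    Measure.smul_apply, Measure.smul_apply]
  have := h.hausdorffMeasure_image_le (d := d) (by positivity)
  simp only [ENNReal.smul_def, smul_eq_mul]
  rw [mul_left_comm]
  gcongr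
  simpa using this

variable {E : Type*} [NormedAddCommGroup E] [InnerProductSpace ℝ E] [MeasurableSpace E]
  [BorelSpace E] {m : ℕ} {b : OrthonormalBasis (Fin (m + 1)) ℝ E}

lemma volume_dropZero_image_le (s : Set E) :
    volume (dropZero b '' s) ≤ Measure.euclideanHausdorffMeasure m s := by
  rw [← EuclideanSpace.euclideanHausdorffMeasure_eq_volume]
  simpa using lipschitzOnWith_euclideanHausdorffMeasure_image_le
    ((lipschitzWith_dropZero b).lipschitzOnWith (s := s)) m

/-- The hypothesis makes the projection injective on `s` with a `K`-Lipschitz inverse, and a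
`K`-Lipschitz map increases `m`-dimensional measure by at most `K ^ m`. -/
lemma euclideanHausdorffMeasure_le_volume_dropZero {K : NNReal} {s : Set E}
    (hK : ∀ p ∈ s, ∀ q ∈ s, ‖p - q‖ ≤ K * ‖dropZero b p - dropZero b q‖) :
    Measure.euclideanHausdorffMeasure m s ≤ K ^ m * volume (dropZero b '' s) := by
  have hinj : InjOn (dropZero b) s := by
    intro p hp q hq h
    have := hK p hp q hq
    rw [h, sub_self, norm_zero, mul_zero] at this
    exact sub_eq_zero.mp (norm_le_zero_iff.mp this)
  rcases s.eq_empty_or_nonempty with rfl | ⟨p0, -⟩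
  · simp
  have : Nonempty E := ⟨p0⟩
  have hleft := hinj.leftInvOn_invFunOn
  have hlip : LipschitzOnWith K (Function.invFunOn (dropZero b) s) (dropZero b '' s) := by
    refine LipschitzOnWith.of_dist_le_mul ?_
    rintro _ ⟨p, hp, rfl⟩ _ ⟨q, hq, rfl⟩
    rw [hleft hp, hleft hq, dist_eq_norm, dist_eq_norm]
    exact hK p hp q hq
  have := lipschitzOnWith_euclideanHausdorffMeasure_image_le hlip m
  rwa [hleft.image_image, EuclideanSpace.euclideanHausdorffMeasure_eq_volume] at this

end HausdorffMeasure

/-! ### Flux in a direction against the surface integral -/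

section Comparison

variable {E : Type*} [NormedAddCommGroup E] [InnerProductSpace ℝ E] [FiniteDimensional ℝ E]
  [MeasurableSpace E] [BorelSpace E] {m : ℕ} {Ω B : Set E} {g : E → ℝ} {e : E}

lemma IsTestFunction.integrable_dirDeriv (hg : IsTestFunction Ω B g) (hΩ : IsOpen Ω)
    (hΩb : Bornology.IsBounded Ω) (e : E) : Integrable (dirDeriv Ω g e) := by
  obtain ⟨C, hC⟩ := hg.norm_dirDeriv_le e
  have hind : Ω.indicator (dirDeriv Ω g e) = dirDeriv Ω g e := by
    simp [dirDeriv, indicator_indicator]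
  rw [← hind, integrable_indicator_iff hΩ.measurableSet]
  exact Measure.integrableOn_of_bounded hΩb.measure_lt_top.ne
    (measurable_dirDeriv hΩ).aestronglyMeasurable (Eventually.of_forall hC)

lemma integral_dirDeriv (hΩ : IsOpen Ω) : ∫ x, dirDeriv Ω g e x = ∫ x in Ω, fderiv ℝ g x e :=
  integral_indicator hΩ.measurableSet

variable {b : OrthonormalBasis (Fin (m + 1)) ℝ E}

lemma IsTestFunction.integral_lineMap_eq (hg : IsTestFunction Ω B g)
    (hΩ : IsOpen Ω) (hBo : IsOpen B) (hB : Bornology.IsBounded B)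
    (hT : IsTransversal Ω B (b 0)) {p : E} (hp : p ∈ frontier Ω ∩ B) :
    ∫ t : ℝ, dirDeriv Ω g (b 0) (lineMap b (dropZero b p) t) = g p := by
  rw [← hg.integral_line_eq hΩ hBo hB (b.orthonormal.ne_zero 0) hT hp,
    ← integral_add_left_eq_self _ (b.repr p 0)]
  simp_rw [lineMap_dropZero_add]

lemma IsTestFunction.integral_lineMap_eq_zero (hg : IsTestFunction Ω B g)
    (hΩ : IsOpen Ω) (hB : Bornology.IsBounded B) {y : EuclideanSpace ℝ (Fin m)}
    (hy : y ∉ dropZero b '' (frontier Ω ∩ B)) :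
    ∫ t : ℝ, dirDeriv Ω g (b 0) (lineMap b y t) = 0 := by
  rw [← hg.integral_line_eq_zero (x := lineMap b y 0) hΩ hB (b.orthonormal.ne_zero 0)]
  · simp_rw [← lineMap_add, zero_add]
  · intro t ht
    refine hy ⟨_, ht, ?_⟩
    rw [← lineMap_add, dropZero_lineMap]

lemma IsTestFunction.integral_lineMap_nonneg (hg : IsTestFunction Ω B g)
    (hΩ : IsOpen Ω) (hBo : IsOpen B) (hB : Bornology.IsBounded B)
    (hT : IsTransversal Ω B (b 0)) (hpos : ∀ p ∈ frontier Ω ∩ B, 0 ≤ g p)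
    (y : EuclideanSpace ℝ (Fin m)) :
    0 ≤ ∫ t : ℝ, dirDeriv Ω g (b 0) (lineMap b y t) := by
  by_cases hy : y ∈ dropZero b '' (frontier Ω ∩ B)
  · obtain ⟨p, hp, rfl⟩ := hy
    rw [hg.integral_lineMap_eq hΩ hBo hB hT hp]
    exact hpos p hp
  · rw [hg.integral_lineMap_eq_zero hΩ hB hy]

/-- The integral of the derivative of a nonnegative function in an outward direction is
nonnegative. -/
lemma IsTestFunction.integral_fderiv_nonneg (hfr : Module.finrank ℝ E = m + 1)
    (hg : IsTestFunction Ω B g) (hΩ : IsOpen Ω) (hΩb : Bornology.IsBounded Ω) (hBo : IsOpen B)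
    (hB : Bornology.IsBounded B) (hT : IsTransversal Ω B e)
    (hpos : ∀ p ∈ frontier Ω ∩ B, 0 ≤ g p) : 0 ≤ ∫ x in Ω, fderiv ℝ g x e := by
  by_cases he : e = 0
  · simp [he]
  have he' : 0 < ‖e‖ := norm_pos_iff.mpr he
  obtain ⟨b, hb⟩ := exists_orthonormalBasis_zero hfr (e := ‖e‖⁻¹ • e)
    (by rw [norm_smul, norm_inv, norm_norm, inv_mul_cancel₀ he'.ne'])
  have hT' : IsTransversal Ω B (b 0) := by
    intro p hp s hs
    rw [hb, smul_smul] at hs ⊢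
    obtain ⟨h1, h2⟩ := hT p hp _ hs
    exact ⟨fun h => h1 (mul_neg_of_neg_of_pos h (by positivity)), fun h => h2 (by positivity)⟩
  have hnn : 0 ≤ ∫ x in Ω, fderiv ℝ g x (b 0) := by
    rw [← integral_dirDeriv hΩ, integral_eq_integral_lineMap b (hg.integrable_dirDeriv hΩ hΩb _)]
    exact integral_nonneg fun y => hg.integral_lineMap_nonneg hΩ hBo hB hT' hpos y
  simp_rw [hb, map_smul, smul_eq_mul] at hnn
  rw [integral_const_mul] at hnn
  exact nonneg_of_mul_nonneg_right hnn (by positivity)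

/-- Comparison of the flux in a direction with the surface integral. -/
lemma IsTestFunction.integral_fderiv_comparison
    (hg : IsTestFunction Ω B g) (hΩ : IsOpen Ω) (hΩb : Bornology.IsBounded Ω) (hBo : IsOpen B)
    (hB : Bornology.IsBounded B) (hT : IsTransversal Ω B (b 0))
    (hpos : ∀ p ∈ frontier Ω ∩ B, 0 ≤ g p) {K : NNReal}
    (hK : ∀ p ∈ frontier Ω ∩ B, ∀ q ∈ frontier Ω ∩ B,
      ‖p - q‖ ≤ K * ‖dropZero b p - dropZero b q‖) :
    ∫ x in Ω, fderiv ℝ g x (b 0) ≤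
        ∫ x in frontier Ω ∩ B, g x ∂(Measure.euclideanHausdorffMeasure m) ∧
      ∫ x in frontier Ω ∩ B, g x ∂(Measure.euclideanHausdorffMeasure m) ≤
        K ^ m * ∫ x in Ω, fderiv ℝ g x (b 0) := by
  set S := frontier Ω ∩ B with hS
  set σ : Measure E := Measure.euclideanHausdorffMeasure m with hσ
  have hSm : MeasurableSet S := isClosed_frontier.measurableSet.inter hBo.measurableSet
  have hπ : Measurable (dropZero b) := (lipschitzWith_dropZero b).continuous.measurable
  have hinj : InjOn (dropZero b) S := by
    intro p hp q hq h
    have := hK p hp q hq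
    rw [h, sub_self, norm_zero, mul_zero] at this
    exact sub_eq_zero.mp (norm_le_zero_iff.mp this)
  have hπS : MeasurableSet (dropZero b '' S) :=
    hSm.image_of_continuousOn_injOn (lipschitzWith_dropZero b).continuous.continuousOn hinj
  set G : EuclideanSpace ℝ (Fin m) → ℝ :=
    fun y => ∫ t : ℝ, dirDeriv Ω g (b 0) (lineMap b y t) with hG
  have hint := hg.integrable_dirDeriv hΩ hΩb (b 0)
  have hGint : Integrable G := integrable_integral_lineMap b hint
  have hGnn : ∀ y, 0 ≤ G y := hg.integral_lineMap_nonneg hΩ hBo hB hT hpos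
  have hI : ∫ x in Ω, fderiv ℝ g x (b 0) = ∫ y, G y ∂(volume.restrict (dropZero b '' S)) := by
    rw [← integral_dirDeriv hΩ, integral_eq_integral_lineMap b hint,
      ← integral_indicator hπS]
    refine integral_congr_ae (Eventually.of_forall fun y => ?_)
    by_cases hy : y ∈ dropZero b '' S
    · exact (indicator_of_mem hy G).symm
    · rw [indicator_of_notMem hy]
      exact hg.integral_lineMap_eq_zero hΩ hB hy
  -- Surface measure pushed down to the plane: it lies between Lebesgue measure on the projection of
  -- `S` and `K ^ m` times it, and `G` pulls back to `g` on `S`.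
  set μ : Measure (EuclideanSpace ℝ (Fin m)) := (σ.restrict S).map (dropZero b) with hμ
  have hle1 : volume.restrict (dropZero b '' S) ≤ μ := by
    refine Measure.le_iff.mpr fun A hA => ?_
    rw [Measure.restrict_apply hA, hμ, Measure.map_apply hπ hA,
      Measure.restrict_apply (hπ hA), inter_comm, ← image_inter_preimage, inter_comm S]
    exact volume_dropZero_image_le _
  have hle2 : μ ≤ (K ^ m : NNReal) • volume.restrict (dropZero b '' S) := by
    refine Measure.le_iff.mpr fun A hA => ?_
    rw [Measure.smul_apply, Measure.restrict_apply hA, hμ, Measure.map_apply hπ hA,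
      Measure.restrict_apply (hπ hA), inter_comm A, ← image_inter_preimage, inter_comm S,
      ENNReal.smul_def, smul_eq_mul]
    push_cast
    exact euclideanHausdorffMeasure_le_volume_dropZero
      fun p hp q hq => hK p hp.2 q hq.2
  have hμint : Integrable G μ := by
    refine Integrable.mono_measure ?_ hle2
    exact hGint.restrict.smul_measure_nnreal
  have hσI : ∫ x in S, g x ∂σ = ∫ y, G y ∂μ := by
    rw [hμ, integral_map hπ.aemeasurable hμint.aestronglyMeasurable]
    exact setIntegral_congr_fun hSm fun p hp => (hg.integral_lineMap_eq hΩ hBo hB hT hp).symm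
  rw [hI, hσI]
  refine ⟨integral_mono_measure hle1 (Eventually.of_forall hGnn) hμint, ?_⟩
  have := integral_mono_measure hle2 (Eventually.of_forall hGnn) hGint.restrict.smul_measure_nnreal
  rwa [integral_smul_nnreal_measure, NNReal.smul_def, smul_eq_mul, NNReal.coe_pow] at this

end Comparison

/-! ### Defining functions, the outer normal and first-order boundary geometry -/

section DefiningFunctions

variable {n : ℕ} {Ω : Set (EuclideanSpace ℝ (Fin n))} {ρ ρ₁ ρ₂ : EuclideanSpace ℝ (Fin n) → ℝ}
  {x y : EuclideanSpace ℝ (Fin n)}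

lemma contDiff_gradient {ρ : EuclideanSpace ℝ (Fin n) → ℝ} (hρ : ContDiff ℝ ∞ ρ) :
    ContDiff ℝ ∞ (gradient ρ) :=
  (InnerProductSpace.toDual ℝ (EuclideanSpace ℝ (Fin n))).symm.contDiff.comp
    (hρ.fderiv_right (m := ∞) (by simp))

/-- Lets a single `ρ` serve all boundary points near `x`, so that quantities defined by pointwise
choice can be shown to be continuous. -/
lemma localDefining_eventually (h : IsLocalDefiningFunction Ω x ρ) :
    ∀ᶠ y in 𝓝 x, IsLocalDefiningFunction Ω y ρ := by
  have h1 : ∀ᶠ y in 𝓝 x, gradient ρ y ≠ 0 :=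
    (contDiff_gradient h.1).continuous.continuousAt.eventually_ne h.2.1
  filter_upwards [h1, h.2.2.eventually_nhds] with y hy1 hy2
  exact ⟨h.1, hy1, hy2⟩

lemma defining_eq_zero (hΩ : IsOpen Ω) (h : IsLocalDefiningFunction Ω x ρ) (hx : x ∈ frontier Ω) :
    ρ x = 0 := by
  rw [hΩ.frontier_eq] at hx
  refine le_antisymm ?_ (not_lt.mp fun hlt => hx.2 (h.2.2.self_of_nhds.mpr hlt))
  by_contra hpos
  have h1 : ∀ᶠ y in 𝓝 x, 0 < ρ y := h.1.continuous.continuousAt.eventually (lt_mem_nhds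
    (not_le.mp hpos))
  obtain ⟨y, hy, hy1, hy2⟩ := ((mem_closure_iff_frequently.mp hx.1).and_eventually
    (h1.and h.2.2)).exists
  exact lt_asymm hy1 (hy2.mp hy)

lemma defining_neg_of_fderiv_neg (h : ContDiff ℝ ∞ ρ) (hx : ρ x = 0)
    {v : EuclideanSpace ℝ (Fin n)} (hv : fderiv ℝ ρ x v < 0) :
    ∀ᶠ t : ℝ in 𝓝[>] 0, ρ (x + t • v) < 0 := by
  have hd : HasDerivAt (fun t : ℝ => ρ (x + t • v)) (fderiv ℝ ρ x v) 0 := by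
    have h1 : HasFDerivAt ρ (fderiv ℝ ρ x) (x + (0 : ℝ) • v) := by
      simpa using (h.differentiable (by simp) x).hasFDerivAt
    exact h1.comp_hasDerivAt 0 (hasDerivAt_line x v 0)
  have := eventually_nhdsWithin_sign_eq_of_deriv_neg (f := fun t : ℝ => ρ (x + t • v))
    (by rw [hd.deriv]; exact hv) (by simpa using hx)
  filter_upwards [nhdsWithin_le_nhds this, self_mem_nhdsWithin] with t ht ht0
  rw [zero_sub, sign_eq_neg_one_iff.mpr (neg_neg_of_pos ht0)] at ht
  exact sign_eq_neg_one_iff.mp ht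

lemma mem_of_fderiv_neg (h : IsLocalDefiningFunction Ω x ρ) (hx : ρ x = 0)
    {v : EuclideanSpace ℝ (Fin n)} (hv : fderiv ℝ ρ x v < 0) :
    ∀ᶠ t : ℝ in 𝓝[>] 0, x + t • v ∈ Ω := by
  have hc : Tendsto (fun t : ℝ => x + t • v) (𝓝[>] 0) (𝓝 x) := by
    have : ContinuousAt (fun t : ℝ => x + t • v) 0 := by fun_prop
    simpa using this.tendsto.mono_left nhdsWithin_le_nhds
  filter_upwards [defining_neg_of_fderiv_neg h.1 hx hv, hc.eventually h.2.2] with t h1 h2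
  exact h2.mpr h1

lemma fderiv_neg_gradient (h : gradient ρ x ≠ 0) : fderiv ℝ ρ x (-gradient ρ x) < 0 := by
  rw [← inner_gradient_left, inner_neg_right, real_inner_self_eq_norm_sq]
  have := norm_pos_iff.mpr h
  nlinarith

lemma mem_frontier_of_defining_eq_zero (hΩ : IsOpen Ω) (h : IsLocalDefiningFunction Ω x ρ)
    (hx : ρ x = 0) : x ∈ frontier Ω := by
  rw [hΩ.frontier_eq]
  refine ⟨?_, fun hmem => (h.2.2.self_of_nhds.mp hmem).ne hx⟩
  refine mem_closure_of_tendsto (f := fun t : ℝ => x + t • -gradient ρ x) (b := 𝓝[>] 0) ?_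
    (mem_of_fderiv_neg h hx (fderiv_neg_gradient h.2.1))
  have : ContinuousAt (fun t : ℝ => x + t • -gradient ρ x) 0 := by fun_prop
  simpa using this.tendsto.mono_left (nhdsWithin_le_nhds (s := Ioi 0))

/-- At a boundary point the tangent cone contains the open half-space `{dρ < 0}`, which spans. This
is what makes derivatives within `closure Ω` meaningful up to the boundary. -/
lemma uniqueDiffOn_closure (hΩ : IsOpen Ω) (hs : HasSmoothBoundary Ω) :
    UniqueDiffOn ℝ (closure Ω) := by
  intro x hx
  by_cases hxΩ : x ∈ Ω
  · exact (hΩ.uniqueDiffWithinAt hxΩ).closure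
  have hfr : x ∈ frontier Ω := by rw [hΩ.frontier_eq]; exact ⟨hx, hxΩ⟩
  obtain ⟨ρ, hρ⟩ := hs x hfr
  refine UniqueDiffWithinAt.closure ⟨?_, hx⟩
  have hsub : {v | fderiv ℝ ρ x v < 0} ⊆ tangentConeAt ℝ Ω x := fun v hv =>
    mem_tangentConeAt_of_add_smul_mem (l := 𝓝[>] (0 : ℝ)) (c := fun t => t)
      (tendsto_id.mono_left (nhdsWithin_mono _ fun t ht => (mem_Ioi.mp ht).ne'))
      (mem_of_fderiv_neg hρ (defining_eq_zero hΩ hρ hfr) hv)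
  have hopen : IsOpen {v | fderiv ℝ ρ x v < 0} :=
    isOpen_lt (fderiv ℝ ρ x).continuous continuous_const
  have htop : Submodule.span ℝ (tangentConeAt ℝ Ω x) = ⊤ := by
    refine Submodule.eq_top_of_nonempty_interior' _ ⟨-gradient ρ x, ?_⟩
    exact interior_mono (hsub.trans Submodule.subset_span)
      (hopen.interior_eq.symm ▸ fderiv_neg_gradient hρ.2.1)
  rw [htop]
  exact dense_univ

/-- The outer unit normal of the sublevel sets of `ρ`. -/
noncomputable def levelNormal (ρ : EuclideanSpace ℝ (Fin n) → ℝ) (x : EuclideanSpace ℝ (Fin n)) :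
    EuclideanSpace ℝ (Fin n) :=
  ‖gradient ρ x‖⁻¹ • gradient ρ x

lemma norm_levelNormal (h : gradient ρ x ≠ 0) : ‖levelNormal ρ x‖ = 1 := by
  rw [levelNormal, norm_smul, norm_inv, norm_norm, inv_mul_cancel₀ (norm_ne_zero_iff.mpr h)]

lemma gradient_eq_smul_levelNormal (h : gradient ρ x ≠ 0) :
    gradient ρ x = ‖gradient ρ x‖ • levelNormal ρ x := by
  rw [levelNormal, smul_smul, mul_inv_cancel₀ (norm_ne_zero_iff.mpr h), one_smul]

/-- A direction that decreases `ρ₁` enters `Ω`, so it cannot increase `ρ₂`. One half-space thus sits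
in the other, and the two gradients are positive multiples of each other. -/
lemma levelNormal_eq (hΩ : IsOpen Ω) (hx : x ∈ frontier Ω) (h₁ : IsLocalDefiningFunction Ω x ρ₁)
    (h₂ : IsLocalDefiningFunction Ω x ρ₂) : levelNormal ρ₁ x = levelNormal ρ₂ x := by
  set a := gradient ρ₁ x with ha
  set b := gradient ρ₂ x with hb
  have ha0 : 0 < ‖a‖ := norm_pos_iff.mpr h₁.2.1
  have hb0 : 0 < ‖b‖ := norm_pos_iff.mpr h₂.2.1
  have hz₁ := defining_eq_zero hΩ h₁ hx
  have hz₂ := defining_eq_zero hΩ h₂ hx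
  have key : ∀ v, inner ℝ a v < 0 → inner ℝ b v ≤ 0 := by
    intro v hv
    by_contra! hpos
    have hv2 : fderiv ℝ ρ₂ x (-(-v)) > 0 := by rw [neg_neg, ← inner_gradient_left]; exact hpos
    have hneg : ContDiff ℝ ∞ (-ρ₂) := h₂.1.neg
    have h3 : ∀ᶠ t : ℝ in 𝓝[>] 0, (-ρ₂) (x + t • v) < 0 :=
      defining_neg_of_fderiv_neg hneg (by simpa using hz₂) (by
        rw [fderiv_neg]
        simpa using hv2)
    have hc : Tendsto (fun t : ℝ => x + t • v) (𝓝[>] 0) (𝓝 x) := by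
      have : ContinuousAt (fun t : ℝ => x + t • v) 0 := by fun_prop
      simpa using this.tendsto.mono_left nhdsWithin_le_nhds
    obtain ⟨t, ht1, ht2, ht3⟩ := (((mem_of_fderiv_neg h₁ hz₁
      (by rw [← inner_gradient_left]; exact hv)).and (h3.and (hc.eventually h₂.2.2)))).exists
    have := ht3.mp ht1
    simp only [Pi.neg_apply] at ht2
    linarith
  have hab : inner ℝ a b = ‖a‖ * ‖b‖ := by
    refine le_antisymm (real_inner_le_norm a b) ?_
    by_contra! hlt
    -- If Cauchy–Schwarz were strict, this vector would have negative product with `a` and positive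
    -- product with `b`.
    have h1 := key (‖a‖ • b - ‖b‖ • a) (by
      rw [inner_sub_right, real_inner_smul_right, real_inner_smul_right,
        real_inner_self_eq_norm_sq]
      nlinarith)
    rw [inner_sub_right, real_inner_smul_right, real_inner_smul_right,
        real_inner_self_eq_norm_sq, real_inner_comm] at h1
    nlinarith
  rw [inner_eq_norm_mul_iff_real] at hab
  rw [levelNormal, levelNormal, ← ha, ← hb]
  have : a = ‖b‖⁻¹ • ‖a‖ • b := by rw [← hab, smul_smul, inv_mul_cancel₀ hb0.ne', one_smul]
  conv_lhs => rw [this]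
  rw [norm_smul, norm_smul, norm_inv, norm_norm, norm_norm, smul_smul, smul_smul]
  congr 1
  field_simp

open Classical in
/-- The outer unit normal of the boundary of `Ω`. -/
noncomputable def outerNormal (Ω : Set (EuclideanSpace ℝ (Fin n)))
    (x : EuclideanSpace ℝ (Fin n)) : EuclideanSpace ℝ (Fin n) :=
  if h : ∃ ρ, IsLocalDefiningFunction Ω x ρ then levelNormal h.choose x else 0

lemma outerNormal_eq (hΩ : IsOpen Ω) (hx : x ∈ frontier Ω) (h : IsLocalDefiningFunction Ω x ρ) :
    outerNormal Ω x = levelNormal ρ x := by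
  have hex : ∃ ρ, IsLocalDefiningFunction Ω x ρ := ⟨ρ, h⟩
  rw [outerNormal, dif_pos hex]
  exact levelNormal_eq hΩ hx hex.choose_spec h

lemma continuousAt_levelNormal (h : ContDiff ℝ ∞ ρ) (hx : gradient ρ x ≠ 0) :
    ContinuousAt (levelNormal ρ) x := by
  have hc := (contDiff_gradient h).continuous.continuousAt (x := x)
  exact (hc.norm.inv₀ (norm_ne_zero_iff.mpr hx)).smul hc

lemma continuousOn_outerNormal (hΩ : IsOpen Ω) (hs : HasSmoothBoundary Ω) :
    ContinuousOn (outerNormal Ω) (frontier Ω) := by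
  intro x hx
  obtain ⟨ρ, hρ⟩ := hs x hx
  refine (continuousAt_levelNormal hρ.1 hρ.2.1).continuousWithinAt.congr_of_eventuallyEq ?_
    (outerNormal_eq hΩ hx hρ)
  filter_upwards [nhdsWithin_le_nhds (localDefining_eventually hρ), self_mem_nhdsWithin]
    with y hy hyf
  exact outerNormal_eq hΩ hyf hy

lemma norm_outerNormal (hΩ : IsOpen Ω) (hs : HasSmoothBoundary Ω) (hx : x ∈ frontier Ω) :
    ‖outerNormal Ω x‖ = 1 := by
  obtain ⟨ρ, hρ⟩ := hs x hx
  rw [outerNormal_eq hΩ hx hρ, norm_levelNormal hρ.2.1]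

/-- First-order expansion of a defining function near a boundary point, uniform in both points. -/
lemma defining_expansion (h : ContDiff ℝ ∞ ρ) (x : EuclideanSpace ℝ (Fin n)) {η : ℝ} (hη : 0 < η) :
    ∃ r > 0, ∀ p ∈ Metric.ball x r, ∀ q ∈ Metric.ball x r,
      |ρ p - ρ q - inner ℝ (gradient ρ x) (p - q)| ≤ η * ‖p - q‖ := by
  have hst := (h.contDiffAt (x := x)).hasStrictFDerivAt (by simp)
  have := hst.isLittleO.def hη
  rw [nhds_prod_eq] at this
  obtain ⟨s, hs, t, ht, hst⟩ := Filter.mem_prod_iff.mp this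
  obtain ⟨r, hr, hrs⟩ := Metric.mem_nhds_iff.mp (inter_mem hs ht)
  refine ⟨r, hr, fun p hp q hq => ?_⟩
  have := hst (mk_mem_prod (hrs hp).1 (hrs hq).2)
  simpa [inner_gradient_left] using this

/-- Along `e` the linear part of `ρ` grows at rate `⟨∇ρ x, e⟩`. The expansion is uniform in both
points, so its error is at most half of this throughout a small ball and `ρ` has the sign of `s`. -/
lemma exists_ball_transversal (hΩ : IsOpen Ω) (h : IsLocalDefiningFunction Ω x ρ) {e : EuclideanSpace ℝ (Fin n)}
    (he : 0 < inner ℝ (gradient ρ x) e) :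
    ∃ r > 0, ∀ r' ≤ r, IsTransversal Ω (Metric.ball x r') e := by
  set D := inner ℝ (gradient ρ x) e with hD
  obtain ⟨r₁, hr₁, h₁⟩ := defining_expansion h.1 x (η := D / (2 * (‖e‖ + 1))) (by positivity)
  obtain ⟨r₂, hr₂, h₂⟩ := Metric.mem_nhds_iff.mp (localDefining_eventually h)
  refine ⟨min r₁ r₂, lt_min hr₁ hr₂, fun r' hr' p hp s hs => ?_⟩
  have hsub₁ : Metric.ball x r' ⊆ Metric.ball x r₁ :=
    Metric.ball_subset_ball (hr'.trans (min_le_left _ _))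
  have hsub₂ : Metric.ball x r' ⊆ Metric.ball x r₂ :=
    Metric.ball_subset_ball (hr'.trans (min_le_right _ _))
  have hp0 : ρ p = 0 := defining_eq_zero hΩ (h₂ (hsub₂ hp.2)) hp.1
  have hexp := h₁ _ (hsub₁ hs) _ (hsub₁ hp.2)
  have hmem := (h₂ (hsub₂ hs)).2.2.self_of_nhds
  rw [add_sub_cancel_left, inner_smul_right, ← hD, hp0, sub_zero, norm_smul, Real.norm_eq_abs]
    at hexp
  have hle : D / (2 * (‖e‖ + 1)) * (|s| * ‖e‖) ≤ D / 2 * |s| := by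
    have : ‖e‖ / (‖e‖ + 1) ≤ 1 := by rw [div_le_one (by positivity)]; linarith
    calc D / (2 * (‖e‖ + 1)) * (|s| * ‖e‖) = D / 2 * |s| * (‖e‖ / (‖e‖ + 1)) := by field_simp
      _ ≤ D / 2 * |s| * 1 := by gcongr
      _ = _ := mul_one _
  have habs := abs_le.mp (hexp.trans hle)
  constructor
  · intro hs0
    rw [hmem]
    rw [abs_of_neg hs0] at habs
    nlinarith [habs.2]
  · intro hs0
    rw [hmem, not_lt]
    rw [abs_of_pos hs0] at habs
    nlinarith [habs.1]

/-- Since `ρ` vanishes at both ends of a chord of the boundary, its linear part is as small as the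
expansion error: short chords are almost tangential. -/
lemma exists_ball_chord (hΩ : IsOpen Ω) (h : IsLocalDefiningFunction Ω x ρ) {η : ℝ} (hη : 0 < η) :
    ∃ r > 0, ∀ p ∈ frontier Ω ∩ Metric.ball x r, ∀ q ∈ frontier Ω ∩ Metric.ball x r,
      |inner ℝ (levelNormal ρ x) (p - q)| ≤ η * ‖p - q‖ := by
  have hg : 0 < ‖gradient ρ x‖ := norm_pos_iff.mpr h.2.1
  obtain ⟨r₁, hr₁, h₁⟩ := defining_expansion h.1 x (η := η * ‖gradient ρ x‖) (by positivity)
  obtain ⟨r₂, hr₂, h₂⟩ := Metric.mem_nhds_iff.mp (localDefining_eventually h)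
  refine ⟨min r₁ r₂, lt_min hr₁ hr₂, fun p hp q hq => ?_⟩
  have hsub₁ := Metric.ball_subset_ball (x := x) (min_le_left r₁ r₂)
  have hsub₂ := Metric.ball_subset_ball (x := x) (min_le_right r₁ r₂)
  have := h₁ p (hsub₁ hp.2) q (hsub₁ hq.2)
  rw [defining_eq_zero hΩ (h₂ (hsub₂ hp.2)) hp.1, defining_eq_zero hΩ (h₂ (hsub₂ hq.2)) hq.1,
    sub_zero, zero_sub, abs_neg] at this
  rw [levelNormal, real_inner_smul_left, abs_mul, abs_inv, abs_norm, inv_mul_le_iff₀ hg]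
  linarith

end DefiningFunctions

/-! ### The divergence theorem near a point, up to a small error -/

section LocalEstimate

variable {m : ℕ} {Ω B : Set (EuclideanSpace ℝ (Fin (m + 1)))}
  {g : EuclideanSpace ℝ (Fin (m + 1)) → ℝ}

lemma IsTestFunction.integrableOn_fderiv (hg : IsTestFunction Ω B g) (hΩ : IsOpen Ω)
    (hΩb : Bornology.IsBounded Ω) (e : EuclideanSpace ℝ (Fin (m + 1))) :
    IntegrableOn (fun x => fderiv ℝ g x e) Ω := by
  have := hg.integrable_dirDeriv hΩ hΩb e
  rwa [dirDeriv, integrable_indicator_iff hΩ.measurableSet] at this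

lemma IsTestFunction.mono {B' : Set (EuclideanSpace ℝ (Fin (m + 1)))} (hg : IsTestFunction Ω B g)
    (h : B ⊆ B') : IsTestFunction Ω B' g :=
  ⟨hg.1, hg.2, hg.3, hg.4.trans h⟩

lemma IsTestFunction.integral_surfaceMeasure (hg : IsTestFunction Ω B g) :
    ∫ x, g x ∂(surfaceMeasure Ω) =
      ∫ x in frontier Ω ∩ B, g x ∂(Measure.euclideanHausdorffMeasure m) := by
  rw [surfaceMeasure]
  refine setIntegral_eq_of_subset_of_forall_sdiff_eq_zero isClosed_frontier.measurableSet
    inter_subset_left fun x hx => image_eq_zero_of_notMem_tsupport fun h => ?_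
  exact hx.2 ⟨hx.1, hg.tsupport_subset h⟩

lemma exists_nnreal_pow_le (m : ℕ) {ε : ℝ} (hε : 0 < ε) :
    ∃ K : NNReal, 1 < K ∧ (K : ℝ) ^ m ≤ 1 + ε := by
  have hc : ContinuousAt (fun K : ℝ => K ^ m) 1 := by fun_prop
  have h1 : ∀ᶠ K in 𝓝[>] (1 : ℝ), K ^ m < 1 + ε :=
    nhdsWithin_le_nhds (hc.eventually (gt_mem_nhds (by simpa using hε)))
  obtain ⟨K, hK, hK1⟩ := (h1.and self_mem_nhdsWithin).exists
  have hK1 : 1 < K := hK1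
  exact ⟨⟨K, by linarith⟩, by exact_mod_cast hK1, hK.le⟩

/-- Pythagoras: if the normal component carries at most the fraction `1 - K⁻²` of `‖z‖²`, the
projection carries at least `K⁻²` of it. -/
lemma norm_le_mul_norm_dropZero {E : Type*} [NormedAddCommGroup E] [InnerProductSpace ℝ E]
    {b : OrthonormalBasis (Fin (m + 1)) ℝ E} {K : ℝ} (hK : 1 < K) {z : E}
    (h : |inner ℝ (b 0) z| ≤ √(1 - (K ^ 2)⁻¹) * ‖z‖) : ‖z‖ ≤ K * ‖dropZero b z‖ := by
  have hK2 : (K ^ 2)⁻¹ ≤ 1 := inv_le_one_of_one_le₀ (by nlinarith)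
  have h1 : inner ℝ (b 0) z ^ 2 ≤ (1 - (K ^ 2)⁻¹) * ‖z‖ ^ 2 := by
    rw [← sq_abs, ← Real.sq_sqrt (sub_nonneg.mpr hK2), ← mul_pow]
    exact pow_le_pow_left₀ (abs_nonneg _) h 2
  have h2 := norm_sq_eq_inner_sq_add b z
  have h3 : (K ^ 2)⁻¹ * ‖z‖ ^ 2 ≤ ‖dropZero b z‖ ^ 2 := by linarith
  rw [inv_mul_le_iff₀ (by positivity), ← mul_pow] at h3
  exact (abs_le_of_sq_le_sq' h3 (by positivity)).2

lemma dropZero_image_isBounded {E : Type*} [NormedAddCommGroup E] [InnerProductSpace ℝ E]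
    (b : OrthonormalBasis (Fin (m + 1)) ℝ E) {s : Set E} (hs : Bornology.IsBounded s) :
    Bornology.IsBounded (dropZero b '' s) :=
  (lipschitzWith_dropZero b).isBounded_image hs

/-- Near a boundary point, the flux of a nonnegative function in a fixed direction is close to the
flux through the tangent plane. -/
lemma exists_ball_flux_estimate (hΩ : IsOpen Ω) (hΩb : Bornology.IsBounded Ω)
    (hs : HasSmoothBoundary Ω) {x : EuclideanSpace ℝ (Fin (m + 1))} (hx : x ∈ frontier Ω)
    (v : EuclideanSpace ℝ (Fin (m + 1))) {ε : ℝ} (hε : 0 < ε) :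
    ∃ r > 0, surfaceMeasure Ω (Metric.ball x r) < ⊤ ∧
      ∀ g, IsTestFunction Ω (Metric.ball x r) g →
        (∀ p ∈ frontier Ω ∩ Metric.ball x r, 0 ≤ g p) →
        |(∫ y in Ω, fderiv ℝ g y v) - inner ℝ v (outerNormal Ω x) * ∫ y, g y ∂(surfaceMeasure Ω)| ≤
          ε * ∫ y, g y ∂(surfaceMeasure Ω) := by
  obtain ⟨ρ, hρ⟩ := hs x hx
  have hν : outerNormal Ω x = levelNormal ρ x := outerNormal_eq hΩ hx hρ
  set ν := levelNormal ρ x with hνdef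
  have hν1 : ‖ν‖ = 1 := norm_levelNormal hρ.2.1
  have hgrad := gradient_eq_smul_levelNormal hρ.2.1
  have hg0 : 0 < ‖gradient ρ x‖ := norm_pos_iff.mpr hρ.2.1
  set a := inner ℝ v ν with ha
  set τ := v - a • ν with hτ
  have hντ : inner ℝ ν τ = 0 := by
    rw [hτ, inner_sub_right, real_inner_smul_right, real_inner_self_eq_norm_sq, hν1,
      real_inner_comm, ← ha]
    ring
  have hfr : Module.finrank ℝ (EuclideanSpace ℝ (Fin (m + 1))) = m + 1 := by simp
  obtain ⟨b, hb⟩ := exists_orthonormalBasis_zero hfr hν1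
  -- The normal flux enters with coefficient `a`, so this tolerance makes its error at most `ε / 2`
  -- times the surface integral; the tangential flux gets the other `ε / 2`.
  obtain ⟨K, hK1, hKm⟩ := exists_nnreal_pow_le m (ε := ε / (2 * (|a| + 1))) (by positivity)
  have hK1' : (1 : ℝ) < K := by exact_mod_cast hK1
  have hη : 0 < √(1 - ((K : ℝ) ^ 2)⁻¹) :=
    Real.sqrt_pos.mpr (sub_pos.mpr (inv_lt_one_of_one_lt₀ (by nlinarith)))
  obtain ⟨r₀, hr₀, h₀⟩ := exists_ball_chord hΩ hρ hη
  obtain ⟨r₁, hr₁, h₁⟩ := exists_ball_transversal hΩ hρ (e := ν)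
    (by rw [hgrad, real_inner_smul_left, real_inner_self_eq_norm_sq, ← hνdef, hν1]; simpa using hρ.2.1)
  -- Both tilted fields `(ε / 2) ν ± τ` still point outwards, so their fluxes are nonnegative; this
  -- bounds the flux along `τ` by `ε / 2` times the flux along `ν`.
  obtain ⟨r₂, hr₂, h₂⟩ := exists_ball_transversal hΩ hρ (e := (ε / 2) • ν + τ)
    (by
      rw [hgrad, real_inner_smul_left, inner_add_right, real_inner_smul_right, ← hνdef, hντ,
        real_inner_self_eq_norm_sq, hν1]
      positivity)
  obtain ⟨r₃, hr₃, h₃⟩ := exists_ball_transversal hΩ hρ (e := (ε / 2) • ν - τ)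
    (by
      rw [hgrad, real_inner_smul_left, inner_sub_right, real_inner_smul_right, ← hνdef, hντ,
        real_inner_self_eq_norm_sq, hν1]
      have : 0 < ε / 2 := by positivity
      simpa using mul_pos hg0 this)
  set r := min (min r₀ r₁) (min r₂ r₃) with hr
  have hr0 : r ≤ r₀ := (min_le_left _ _).trans (min_le_left _ _)
  have hr1 : r ≤ r₁ := (min_le_left _ _).trans (min_le_right _ _)
  have hr2 : r ≤ r₂ := (min_le_right _ _).trans (min_le_left _ _)
  have hr3 : r ≤ r₃ := (min_le_right _ _).trans (min_le_right _ _)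
  have hK : ∀ p ∈ frontier Ω ∩ Metric.ball x r, ∀ q ∈ frontier Ω ∩ Metric.ball x r,
      ‖p - q‖ ≤ K * ‖dropZero b p - dropZero b q‖ := by
    intro p hp q hq
    rw [← dropZero_sub]
    refine norm_le_mul_norm_dropZero hK1' ?_
    rw [hb]
    exact h₀ p ⟨hp.1, Metric.ball_subset_ball hr0 hp.2⟩ q ⟨hq.1, Metric.ball_subset_ball hr0 hq.2⟩
  refine ⟨r, by positivity, ?_, fun g hg hpos => ?_⟩
  · rw [surfaceMeasure, Measure.restrict_apply Metric.isOpen_ball.measurableSet, inter_comm]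
    refine (euclideanHausdorffMeasure_le_volume_dropZero hK).trans_lt (ENNReal.mul_lt_top ?_ ?_)
    · exact ENNReal.pow_lt_top ENNReal.coe_lt_top
    · exact (dropZero_image_isBounded b
        (Metric.isBounded_ball.subset inter_subset_right)).measure_lt_top
  have hBo : IsOpen (Metric.ball x r) := Metric.isOpen_ball
  have hBb : Bornology.IsBounded (Metric.ball x r) := Metric.isBounded_ball
  have hplus := hg.integral_fderiv_nonneg hfr hΩ hΩb hBo hBb (h₂ r hr2) hpos
  have hminus := hg.integral_fderiv_nonneg hfr hΩ hΩb hBo hBb (h₃ r hr3) hpos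
  have hcomp := hg.integral_fderiv_comparison (b := b) hΩ hΩb hBo hBb
    (by rw [hb]; exact h₁ r hr1) hpos hK
  rw [← hg.integral_surfaceMeasure, hb] at hcomp
  have hint := hg.integrableOn_fderiv hΩ hΩb
  simp only [map_add, map_sub, map_smul, smul_eq_mul] at hplus hminus
  rw [integral_add ((hint ν).const_mul _) (hint τ), integral_const_mul] at hplus
  rw [integral_sub ((hint ν).const_mul _) (hint τ), integral_const_mul] at hminus
  have hv : v = a • ν + τ := by rw [hτ]; abel
  have hvI : ∫ y in Ω, fderiv ℝ g y v =
      a * (∫ y in Ω, fderiv ℝ g y ν) + ∫ y in Ω, fderiv ℝ g y τ := by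
    rw [← integral_const_mul, ← integral_add ((hint ν).const_mul _) (hint τ)]
    refine integral_congr_ae (Eventually.of_forall fun y => ?_)
    conv_lhs => rw [hv]
    simp
  rw [hvI, hν, ← ha]
  set I := ∫ y in Ω, fderiv ℝ g y ν
  set J := ∫ y in Ω, fderiv ℝ g y τ
  set S := ∫ y, g y ∂(surfaceMeasure Ω)
  have hI0 : 0 ≤ I := by
    have := hg.integral_fderiv_nonneg hfr hΩ hΩb hBo hBb (h₁ r hr1) hpos
    exact this
  have hS0 : 0 ≤ S := hI0.trans hcomp.1
  have hSI : S - I ≤ ε / (2 * (|a| + 1)) * S := by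
    have h5 : S ≤ (1 + ε / (2 * (|a| + 1))) * I :=
      hcomp.2.trans (mul_le_mul_of_nonneg_right hKm hI0)
    have h6 : ε / (2 * (|a| + 1)) * I ≤ ε / (2 * (|a| + 1)) * S :=
      mul_le_mul_of_nonneg_left hcomp.1 (by positivity)
    linarith
  have h7 : |a| * (S - I) ≤ ε / 2 * S := by
    calc |a| * (S - I) ≤ (|a| + 1) * (ε / (2 * (|a| + 1)) * S) :=
          mul_le_mul (by linarith) hSI (by linarith [hcomp.1]) (by positivity)
      _ = ε / 2 * S := by field_simp
  have h8 : |J| ≤ ε / 2 * S := by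
    have : ε / 2 * I ≤ ε / 2 * S := mul_le_mul_of_nonneg_left hcomp.1 (by positivity)
    exact abs_le.mpr ⟨by linarith, by linarith⟩
  calc |a * I + J - a * S| = |-(a * (S - I)) + J| := by congr 1; ring
    _ ≤ |-(a * (S - I))| + |J| := abs_add_le _ _
    _ = |a| * (S - I) + |J| := by
      rw [abs_neg, abs_mul, abs_of_nonneg (sub_nonneg.mpr hcomp.1)]
    _ ≤ ε * S := by linarith

lemma continuousOn_inner_outerNormal (hΩ : IsOpen Ω) (hs : HasSmoothBoundary Ω)
    (v : EuclideanSpace ℝ (Fin (m + 1))) :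
    ContinuousOn (fun y => inner ℝ v (outerNormal Ω y)) (frontier Ω) :=
  continuousOn_const.inner (continuousOn_outerNormal hΩ hs)

lemma isCompact_frontier (hΩb : Bornology.IsBounded Ω) : IsCompact (frontier Ω) :=
  hΩb.isCompact_closure.of_isClosed_subset isClosed_frontier frontier_subset_closure

lemma isFiniteMeasure_surfaceMeasure (hΩ : IsOpen Ω) (hΩb : Bornology.IsBounded Ω)
    (hs : HasSmoothBoundary Ω) : IsFiniteMeasure (surfaceMeasure Ω) := by
  refine ⟨?_⟩
  have h1 : surfaceMeasure Ω (frontier Ω) < ⊤ := by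
    refine (isCompact_frontier hΩb).measure_lt_top_of_nhdsWithin fun x hx => ?_
    obtain ⟨r, hr, hfin, -⟩ := exists_ball_flux_estimate hΩ hΩb hs hx 0 one_pos
    exact ⟨_, nhdsWithin_le_nhds (Metric.ball_mem_nhds x hr), hfin⟩
  rw [surfaceMeasure, Measure.restrict_apply_self] at h1
  rwa [surfaceMeasure, Measure.restrict_apply_univ]

lemma ae_mem_frontier : ∀ᵐ x ∂(surfaceMeasure Ω), x ∈ frontier Ω :=
  ae_restrict_mem isClosed_frontier.measurableSet

lemma integrable_of_continuousOn_frontier {F : Type*} [NormedAddCommGroup F] (hΩ : IsOpen Ω)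
    (hΩb : Bornology.IsBounded Ω) (hs : HasSmoothBoundary Ω)
    {f : EuclideanSpace ℝ (Fin (m + 1)) → F} (hf : ContinuousOn f (frontier Ω)) :
    Integrable f (surfaceMeasure Ω) := by
  have hfin := isFiniteMeasure_surfaceMeasure hΩ hΩb hs
  obtain ⟨C, hC⟩ := (isCompact_frontier hΩb).exists_bound_of_continuousOn hf
  exact Integrable.of_bound (hf.aestronglyMeasurable_of_isCompact (isCompact_frontier hΩb)
    isClosed_frontier.measurableSet) C ((ae_restrict_mem isClosed_frontier.measurableSet).mono hC)

lemma integrable_mul_inner_outerNormal (hΩ : IsOpen Ω) (hΩb : Bornology.IsBounded Ω)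
    (hs : HasSmoothBoundary Ω) (hg : ContinuousOn g (frontier Ω))
    (v : EuclideanSpace ℝ (Fin (m + 1))) :
    Integrable (fun y => g y * inner ℝ v (outerNormal Ω y)) (surfaceMeasure Ω) :=
  integrable_of_continuousOn_frontier hΩ hΩb hs (hg.mul (continuousOn_inner_outerNormal hΩ hs v))

/-- Local form of the divergence theorem up to a small error, near an arbitrary point. -/
lemma exists_nhds_flux_estimate (hΩ : IsOpen Ω) (hΩb : Bornology.IsBounded Ω)
    (hs : HasSmoothBoundary Ω) (x v : EuclideanSpace ℝ (Fin (m + 1))) {ε : ℝ} (hε : 0 < ε) :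
    ∃ B, IsOpen B ∧ x ∈ B ∧ ∀ g, IsTestFunction Ω B g → (∀ p ∈ frontier Ω ∩ B, 0 ≤ g p) →
      |(∫ y in Ω, fderiv ℝ g y v) - ∫ y, g y * inner ℝ v (outerNormal Ω y) ∂(surfaceMeasure Ω)| ≤
          ε * ∫ y, g y ∂(surfaceMeasure Ω) := by
  have hfr : Module.finrank ℝ (EuclideanSpace ℝ (Fin (m + 1))) = m + 1 := by simp
  by_cases hx : x ∈ frontier Ω
  · obtain ⟨r, hr, -, hest⟩ := exists_ball_flux_estimate hΩ hΩb hs hx v (half_pos hε)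
    have hνc : ContinuousWithinAt (fun y => inner ℝ v (outerNormal Ω y)) (frontier Ω) x :=
      (continuousOn_inner_outerNormal hΩ hs v) x hx
    obtain ⟨r', hr', hν⟩ := Metric.mem_nhdsWithin_iff.mp
      (hνc.eventually (Metric.ball_mem_nhds _ (half_pos hε)))
    refine ⟨Metric.ball x (min r r'), Metric.isOpen_ball, Metric.mem_ball_self (by positivity),
      fun g hg hpos => ?_⟩
    have hsub := Metric.ball_subset_ball (x := x) (min_le_left r r')
    have hzero : ∀ y, y ∉ Metric.ball x (min r r') → g y = 0 := fun y hy =>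
      image_eq_zero_of_notMem_tsupport fun h => hy (hg.tsupport_subset h)
    have h1 := hest g (hg.mono hsub) (fun p hp => by
      by_cases h : p ∈ Metric.ball x (min r r')
      · exact hpos p ⟨hp.1, h⟩
      · exact (hzero p h).ge)
    have hgc : ContinuousOn g (frontier Ω) := hg.continuousOn.mono frontier_subset_closure
    have hgi := integrable_of_continuousOn_frontier hΩ hΩb hs hgc
    have hgνi := integrable_mul_inner_outerNormal hΩ hΩb hs hgc v
    have h2 : |inner ℝ v (outerNormal Ω x) * ∫ y, g y ∂(surfaceMeasure Ω) -
        ∫ y, g y * inner ℝ v (outerNormal Ω y) ∂(surfaceMeasure Ω)| ≤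
        ε / 2 * ∫ y, g y ∂(surfaceMeasure Ω) := by
      rw [← integral_const_mul, ← integral_const_mul, ← integral_sub (hgi.const_mul _) hgνi,
        ← Real.norm_eq_abs]
      refine norm_integral_le_of_norm_le (hgi.const_mul _) ?_
      filter_upwards [ae_mem_frontier] with y hy
      by_cases h : y ∈ Metric.ball x (min r r')
      · have h3 := hν ⟨Metric.ball_subset_ball (min_le_right r r') h, hy⟩
        have h4 := hpos y ⟨hy, h⟩
        rw [mem_ofPred_eq, dist_comm, dist_eq_norm] at h3
        rw [mul_comm (g y), ← sub_mul, norm_mul, Real.norm_of_nonneg h4]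
        exact mul_le_mul_of_nonneg_right h3.le h4
      · simp [hzero y h]
    calc _ ≤ _ := abs_sub_le _ (inner ℝ v (outerNormal Ω x) * ∫ y, g y ∂(surfaceMeasure Ω)) _
      _ ≤ ε / 2 * (∫ y, g y ∂(surfaceMeasure Ω)) + ε / 2 * ∫ y, g y ∂(surfaceMeasure Ω) :=
        add_le_add h1 h2
      _ = _ := by ring
  · obtain ⟨r, hr, hball⟩ := Metric.mem_nhds_iff.mp (isClosed_frontier.isOpen_compl.mem_nhds hx)
    refine ⟨Metric.ball x r, Metric.isOpen_ball, Metric.mem_ball_self hr, fun g hg hpos => ?_⟩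
    have hempty : ∀ p ∈ frontier Ω ∩ Metric.ball x r, False := fun p hp => hball hp.2 hp.1
    -- Away from the boundary every direction is vacuously transversal, so the fluxes along `v` and
    -- `-v` are both nonnegative, hence zero.
    have hT : ∀ e, IsTransversal Ω (Metric.ball x r) e := fun e p hp => (hempty p hp).elim
    have h1 := hg.integral_fderiv_nonneg hfr hΩ hΩb Metric.isOpen_ball Metric.isBounded_ball
      (hT v) hpos
    have h2 := hg.integral_fderiv_nonneg hfr hΩ hΩb Metric.isOpen_ball Metric.isBounded_ball
      (hT (-v)) hpos
    simp only [map_neg, integral_neg] at h2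
    have hg0 : g =ᵐ[surfaceMeasure Ω] fun _ => 0 := by
      filter_upwards [ae_mem_frontier] with y hy
      exact image_eq_zero_of_notMem_tsupport fun h => hball (hg.tsupport_subset h) hy
    have h3 : (fun y => g y * inner ℝ v (outerNormal Ω y)) =ᵐ[surfaceMeasure Ω] fun _ => 0 := by
      filter_upwards [hg0] with y hy
      simp [hy]
    rw [integral_congr_ae h3, integral_congr_ae hg0, le_antisymm (by linarith) h1]
    simp

end LocalEstimate

/-! ### The divergence theorem on `Ω` -/

section Global

variable {m : ℕ} {Ω : Set (EuclideanSpace ℝ (Fin (m + 1)))}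
  {g : EuclideanSpace ℝ (Fin (m + 1)) → ℝ}

lemma exists_bound_fderiv {E F : Type*} [NormedAddCommGroup E] [NormedSpace ℝ E]
    [NormedAddCommGroup F] [NormedSpace ℝ F] {Ω : Set E} {g : E → F}
    (hΩ : IsOpen Ω) (hc : IsCompact (closure Ω)) (hu : UniqueDiffOn ℝ (closure Ω))
    (hg : ContDiffOn ℝ 1 g (closure Ω)) : ∃ C, ∀ x ∈ Ω, ‖fderiv ℝ g x‖ ≤ C := by
  obtain ⟨C, hC⟩ := hc.exists_bound_of_continuousOn (hg.continuousOn_fderivWithin hu le_rfl)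
  refine ⟨C, fun x hx => ?_⟩
  rw [← fderivWithin_of_mem_nhds (mem_of_superset (hΩ.mem_nhds hx) subset_closure)]
  exact hC x (subset_closure hx)

lemma isTestFunction_of_contDiffOn {B : Set (EuclideanSpace ℝ (Fin (m + 1)))} (hΩ : IsOpen Ω)
    (hΩb : Bornology.IsBounded Ω) (hs : HasSmoothBoundary Ω) (hg : ContDiffOn ℝ 1 g (closure Ω))
    (hB : tsupport g ⊆ B) : IsTestFunction Ω B g :=
  ⟨hg.continuousOn, (hg.mono subset_closure).differentiableOn (by simp),
    exists_bound_fderiv hΩ hΩb.isCompact_closure (uniqueDiffOn_closure hΩ hs) hg, hB⟩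

lemma exists_finite_smooth_partition {E : Type*} [NormedAddCommGroup E] [NormedSpace ℝ E]
    [FiniteDimensional ℝ E] {s : Set E} (hs : IsCompact s) {U : E → Set E}
    (hU : ∀ x, IsOpen (U x)) (hxU : ∀ x, x ∈ U x) :
    ∃ (t : Finset E) (χ : t → E → ℝ), (∀ i, ContDiff ℝ ∞ (χ i)) ∧ (∀ i x, 0 ≤ χ i x) ∧
      (∀ i, tsupport (χ i) ⊆ U i) ∧ ∀ x ∈ s, ∑ i, χ i x = 1 := by
  obtain ⟨t, ht⟩ := hs.elim_finite_subcover U hU fun x _ => mem_iUnion.mpr ⟨x, hxU x⟩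
  obtain ⟨f, hf⟩ := SmoothPartitionOfUnity.exists_isSubordinate (modelWithCornersSelf ℝ E)
    hs.isClosed (fun i : t => U i) (fun i => hU i) (by
      intro x hx
      obtain ⟨i, hi, hxi⟩ := mem_iUnion₂.mp (ht hx)
      exact mem_iUnion.mpr ⟨⟨i, hi⟩, hxi⟩)
  refine ⟨t, fun i => f i, fun i => (f i).contMDiff.contDiff, fun i x => f.nonneg i x,
    fun i => hf i, fun x hx => ?_⟩
  rw [← finsum_eq_sum_of_fintype]
  exact f.sum_eq_one hx

/-- Nonnegativity makes the local errors add up: the pieces `χ i * g` have errors `ε ∫ χ i * g dσ`,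
whose sum is `ε ∫ g dσ` however many pieces the partition has. -/
lemma integral_fderiv_eq_of_nonneg (hΩ : IsOpen Ω) (hΩb : Bornology.IsBounded Ω)
    (hs : HasSmoothBoundary Ω) (hg : ContDiffOn ℝ 1 g (closure Ω))
    (hpos : ∀ x ∈ closure Ω, 0 ≤ g x) (v : EuclideanSpace ℝ (Fin (m + 1))) :
    ∫ x in Ω, fderiv ℝ g x v = ∫ x, g x * inner ℝ v (outerNormal Ω x) ∂(surfaceMeasure Ω) := by
  set S := ∫ x, g x ∂(surfaceMeasure Ω) with hS
  suffices h : ∀ ε > 0, |(∫ x in Ω, fderiv ℝ g x v) -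
      ∫ x, g x * inner ℝ v (outerNormal Ω x) ∂(surfaceMeasure Ω)| ≤ ε * S by
    refine sub_eq_zero.mp (abs_eq_zero.mp (le_antisymm ?_ (abs_nonneg _)))
    refine le_of_forall_pos_le_add fun δ hδ => ?_
    have hS0 : 0 ≤ S := integral_nonneg_of_ae (ae_mem_frontier.mono fun x hx =>
      hpos x (frontier_subset_closure hx))
    refine (h (δ / (S + 1)) (by positivity)).trans ?_
    rw [div_mul_eq_mul_div, zero_add, div_le_iff₀ (by positivity)]
    nlinarith
  intro ε hε
  choose U hUo hxU hest using fun x => exists_nhds_flux_estimate hΩ hΩb hs x v hε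
  obtain ⟨t, χ, hχ, hχ0, hχs, hχ1⟩ := exists_finite_smooth_partition hΩb.isCompact_closure hUo hxU
  have hχg : ∀ i, ContDiffOn ℝ 1 (fun x => χ i x * g x) (closure Ω) := fun i =>
    ((hχ i).of_le (by simp)).contDiffOn.mul hg
  have htest : ∀ i : t, IsTestFunction Ω (U i) fun x => χ i x * g x := fun i : t =>
    isTestFunction_of_contDiffOn hΩ hΩb hs (hχg i)
      ((tsupport_mul_subset_left).trans (hχs i))
  have hle := fun i : t => hest i _ (htest i) fun p hp =>
    mul_nonneg (hχ0 i p) (hpos p (frontier_subset_closure hp.1))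
  have hcf : ∀ i, ContinuousOn (fun x => χ i x * g x) (frontier Ω) := fun i =>
    (hχg i).continuousOn.mono frontier_subset_closure
  have hsumg : ∀ x ∈ closure Ω, ∑ i, χ i x * g x = g x := fun x hx => by
    rw [← Finset.sum_mul, hχ1 x hx, one_mul]
  have e1 : ∫ x in Ω, fderiv ℝ g x v = ∑ i, ∫ x in Ω, fderiv ℝ (fun x => χ i x * g x) x v := by
    rw [← integral_finsetSum _ fun i _ => (htest i).integrableOn_fderiv hΩ hΩb v]
    refine setIntegral_congr_fun hΩ.measurableSet fun x hx => ?_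
    have hev : g =ᶠ[𝓝 x] fun y => ∑ i, χ i y * g y := by
      filter_upwards [hΩ.mem_nhds hx] with y hy
      exact (hsumg y (subset_closure hy)).symm
    rw [hev.fderiv_eq, fderiv_fun_sum]
    · simp
    · exact fun i _ => ((htest i).differentiableOn x hx).differentiableAt (hΩ.mem_nhds hx)
  have e2 : ∫ x, g x * inner ℝ v (outerNormal Ω x) ∂(surfaceMeasure Ω) =
      ∑ i, ∫ x, χ i x * g x * inner ℝ v (outerNormal Ω x) ∂(surfaceMeasure Ω) := by
    rw [← integral_finsetSum _ fun i _ => integrable_mul_inner_outerNormal hΩ hΩb hs (hcf i) v]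
    refine integral_congr_ae (ae_mem_frontier.mono fun x hx => ?_)
    simp only
    rw [← Finset.sum_mul, hsumg x (frontier_subset_closure hx)]
  have e3 : S = ∑ i, ∫ x, χ i x * g x ∂(surfaceMeasure Ω) := by
    rw [← integral_finsetSum _ fun i _ => integrable_of_continuousOn_frontier hΩ hΩb hs (hcf i)]
    exact integral_congr_ae (ae_mem_frontier.mono fun x hx =>
      (hsumg x (frontier_subset_closure hx)).symm)
  rw [e1, e2, e3, ← Finset.sum_sub_distrib, Finset.mul_sum]
  exact (Finset.abs_sum_le_sum_abs _ _).trans (Finset.sum_le_sum fun i _ => hle i)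

theorem integral_fderiv_eq (hΩ : IsOpen Ω) (hΩb : Bornology.IsBounded Ω)
    (hs : HasSmoothBoundary Ω) (hg : ContDiffOn ℝ 1 g (closure Ω))
    (v : EuclideanSpace ℝ (Fin (m + 1))) :
    ∫ x in Ω, fderiv ℝ g x v = ∫ x, g x * inner ℝ v (outerNormal Ω x) ∂(surfaceMeasure Ω) := by
  obtain ⟨C, hC⟩ := hΩb.isCompact_closure.exists_bound_of_continuousOn hg.continuousOn
  -- Adding a constant makes `g` nonnegative without changing its derivative; the same formula for
  -- the constant alone removes its boundary term.
  have h1 := integral_fderiv_eq_of_nonneg hΩ hΩb hs (g := fun x => g x + max C 0)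
    (hg.add contDiffOn_const) (fun x hx => by
      have := hC x hx
      rw [Real.norm_eq_abs] at this
      have := (abs_le.mp this).1
      have := le_max_left C 0
      linarith) v
  have h2 := integral_fderiv_eq_of_nonneg hΩ hΩb hs (g := fun _ => max C 0)
    contDiffOn_const (fun _ _ => le_max_right C 0) v
  simp only [fderiv_fun_const, fderiv_add_const, Pi.zero_apply, zero_apply,
    integral_zero] at h1 h2
  rw [h1]
  simp_rw [add_mul]
  rw [integral_add, ← h2, add_zero]
  · exact integrable_mul_inner_outerNormal hΩ hΩb hs
      (hg.continuousOn.mono frontier_subset_closure) v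
  · exact integrable_mul_inner_outerNormal hΩ hΩb hs continuousOn_const v

/-- The divergence theorem on a bounded domain with smooth boundary. -/
theorem integral_divergence_eq (hΩ : IsOpen Ω) (hΩb : Bornology.IsBounded Ω)
    (hs : HasSmoothBoundary Ω)
    {X : EuclideanSpace ℝ (Fin (m + 1)) → EuclideanSpace ℝ (Fin (m + 1))}
    (hX : ContDiffOn ℝ 1 X (closure Ω)) :
    ∫ x in Ω, ∑ i, fderiv ℝ X x (EuclideanSpace.single i 1) i =
      ∫ x, inner ℝ (X x) (outerNormal Ω x) ∂(surfaceMeasure Ω) := by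
  have hXi : ∀ i, ContDiffOn ℝ 1 (fun x => X x i) (closure Ω) := fun i =>
    (contDiffOn_euclidean.mp hX) i
  have hd : ∀ x ∈ Ω, ∀ i v, fderiv ℝ X x v i = fderiv ℝ (fun y => X y i) x v := by
    intro x hx i v
    have hdx : DifferentiableAt ℝ X x :=
      ((hX.mono subset_closure).differentiableOn (by simp) x hx).differentiableAt (hΩ.mem_nhds hx)
    have := ((EuclideanSpace.proj (𝕜 := ℝ) i).hasFDerivAt.comp x hdx.hasFDerivAt).fderiv
    change _ = fderiv ℝ (EuclideanSpace.proj (𝕜 := ℝ) i ∘ X) x v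
    rw [this]
    rfl
  have e1 : ∫ x in Ω, ∑ i, fderiv ℝ X x (EuclideanSpace.single i 1) i =
      ∑ i, ∫ x in Ω, fderiv ℝ (fun y => X y i) x (EuclideanSpace.single i 1) := by
    rw [← integral_finsetSum]
    · refine setIntegral_congr_fun hΩ.measurableSet fun x hx => ?_
      exact Finset.sum_congr rfl fun i _ => hd x hx i _
    · exact fun i _ => (isTestFunction_of_contDiffOn hΩ hΩb hs (hXi i)
        (subset_univ _)).integrableOn_fderiv hΩ hΩb _
  rw [e1]
  simp_rw [integral_fderiv_eq hΩ hΩb hs (hXi _)]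
  rw [← integral_finsetSum]
  · refine integral_congr_ae (Eventually.of_forall fun x => ?_)
    simp [PiLp.inner_apply, mul_comm]
  · exact fun i _ => integrable_mul_inner_outerNormal hΩ hΩb hs
      ((hXi i).continuousOn.mono frontier_subset_closure) _

end Global

/-! ### Curves in the boundary and their normal acceleration -/

section BoundaryCurves

/-- Second-order consequence of the constancy of a function along a curve. -/
lemma second_derivative_along_curve {E : Type*} [NormedAddCommGroup E] [NormedSpace ℝ E]
    {s : Set E} {f : E → ℝ} {f' : E → E →L[ℝ] ℝ} {f'' : E →L[ℝ] E →L[ℝ] ℝ} {γ : ℝ → E} {c : ℝ}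
    (hf : ∀ y ∈ s, HasFDerivWithinAt f (f' y) s y) (hf' : HasFDerivWithinAt f' f'' s (γ 0))
    (hγ : ContDiffAt ℝ ∞ γ 0) (hγs : ∀ᶠ t in 𝓝 0, γ t ∈ s) (hγc : ∀ᶠ t in 𝓝 0, f (γ t) = c) :
    f' (γ 0) (deriv γ 0) = 0 ∧
      f'' (deriv γ 0) (deriv γ 0) + f' (γ 0) (deriv (deriv γ) 0) = 0 := by
  have hγ1 : ∀ᶠ t in 𝓝 0, DifferentiableAt ℝ γ t := by
    filter_upwards [(hγ.of_le (m := 1) (by simp)).eventually (by simp)] with t ht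
    exact ht.differentiableAt (by simp)
  have hγ2 : HasDerivAt (deriv γ) (deriv (deriv γ) 0) 0 := by
    have : ContDiffAt ℝ 1 (fun t => fderiv ℝ γ t 1) 0 :=
      (hγ.fderiv_right (m := 1) (by norm_cast)).clm_apply contDiffAt_const
    exact (this.differentiableAt (by simp)).hasDerivAt
  -- The first-order relation holds for all small `t`, not only at `0`, so it can be differentiated
  -- once more.
  have hzero : ∀ᶠ t in 𝓝 0, f' (γ t) (deriv γ t) = 0 := by
    filter_upwards [hγ1, hγs.eventually_nhds, hγc.eventually_nhds] with t h1 h2 h3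
    have hd := (hf (γ t) h2.self_of_nhds).comp_hasDerivAt t h1.hasDerivAt h2
    have hd0 : HasDerivAt (f ∘ γ) 0 t := (hasDerivAt_const t c).congr_of_eventuallyEq h3
    exact hd.unique hd0
  refine ⟨hzero.self_of_nhds, ?_⟩
  have hd1 : HasDerivAt (fun t => f' (γ t)) (f'' (deriv γ 0)) 0 :=
    hf'.comp_hasDerivAt 0 hγ1.self_of_nhds.hasDerivAt hγs
  have hd := hd1.clm_apply hγ2
  exact hd.unique ((hasDerivAt_const (0 : ℝ) (0 : ℝ)).congr_of_eventuallyEq hzero)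

variable {n : ℕ} {Ω : Set (EuclideanSpace ℝ (Fin n))} {ρ ρ₁ ρ₂ : EuclideanSpace ℝ (Fin n) → ℝ}
  {x τ : EuclideanSpace ℝ (Fin n)}

/-- Every tangent vector is the velocity of a smooth curve in the boundary. -/
lemma exists_boundary_curve (hΩ : IsOpen Ω) (hx : x ∈ frontier Ω)
    (h : IsLocalDefiningFunction Ω x ρ) (hτ : inner ℝ (levelNormal ρ x) τ = 0) :
    ∃ γ : ℝ → EuclideanSpace ℝ (Fin n), ContDiffAt ℝ ∞ γ 0 ∧ γ 0 = x ∧ deriv γ 0 = τ ∧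
      ∀ᶠ t in 𝓝 0, γ t ∈ frontier Ω := by
  set ν := levelNormal ρ x with hν
  set a := ‖gradient ρ x‖ with ha
  have ha0 : a ≠ 0 := norm_ne_zero_iff.mpr h.2.1
  have hν1 : inner ℝ ν ν = 1 := by
    rw [real_inner_self_eq_norm_sq, norm_levelNormal h.2.1, one_pow]
  have hρx := defining_eq_zero hΩ h hx
  -- A straightening map: the height of `Φ y` over the tangent plane at `x` is `ρ y / a`, and its
  -- derivative at `x` is the identity. The curve is the image of the line `x + t τ` under the local
  -- inverse.
  set Φ : EuclideanSpace ℝ (Fin n) → EuclideanSpace ℝ (Fin n) :=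
    fun y => y + (a⁻¹ * ρ y - inner ℝ ν (y - x)) • ν with hΦ
  have hΦx : Φ x = x := by simp [hΦ, hρx]
  have hΦc : ContDiffAt ℝ ∞ Φ x := by
    have h1 : ContDiff ℝ ∞ fun y => a⁻¹ * ρ y - inner ℝ ν (y - x) :=
      (contDiff_const.mul h.1).sub (contDiff_const.inner ℝ (contDiff_id.sub contDiff_const))
    exact (contDiff_id.add (h1.smul contDiff_const)).contDiffAt
  have hΦd : HasFDerivAt Φ ((ContinuousLinearEquiv.refl ℝ (EuclideanSpace ℝ (Fin n)) :
      EuclideanSpace ℝ (Fin n) →L[ℝ] EuclideanSpace ℝ (Fin n))) x := by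
    have h1 : HasFDerivAt ρ (fderiv ℝ ρ x) x := (h.1.differentiable (by simp) x).hasFDerivAt
    have h2 : HasFDerivAt (fun y => inner ℝ ν (y - x)) (innerSL ℝ ν) x :=
      ((innerSL ℝ ν).hasFDerivAt.comp x ((hasFDerivAt_id x).sub_const x)).congr_fderiv
        (ContinuousLinearMap.comp_id _)
    have h3 := (hasFDerivAt_id x).add (((h1.const_mul a⁻¹).sub h2).smul_const ν)
    refine h3.congr_fderiv ?_
    ext1 v
    have : fderiv ℝ ρ x v = a * inner ℝ ν v := by
      rw [← inner_gradient_left, gradient_eq_smul_levelNormal h.2.1, real_inner_smul_left]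
    simp [this, ha0]
  have hst := hΦc.hasStrictFDerivAt' hΦd (by simp)
  set ψ := hΦc.localInverse hΦd (by simp) with hψ
  have hψc : ContDiffAt ℝ ∞ ψ x := by
    have := hΦc.to_localInverse hΦd (by simp)
    rwa [hΦx] at this
  have hψx : ψ x = x := by
    have := hΦc.localInverse_apply_image hΦd (by simp)
    rwa [hΦx] at this
  have hψd : HasFDerivAt ψ (ContinuousLinearMap.id ℝ (EuclideanSpace ℝ (Fin n))) x := by
    have := hst.to_localInverse.hasFDerivAt
    rw [hΦx] at this
    exact this
  have hright : ∀ᶠ y in 𝓝 x, Φ (ψ y) = y := by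
    have := hst.eventually_right_inverse
    rwa [hΦx] at this
  have hlx : x + (0 : ℝ) • τ = x := by simp
  have hline : ContinuousAt (fun t : ℝ => x + t • τ) 0 := by fun_prop
  have hγc : ContDiffAt ℝ ∞ (fun t : ℝ => ψ (x + t • τ)) 0 := by
    refine ContDiffAt.comp (g := ψ) (f := fun t : ℝ => x + t • τ) (0 : ℝ) (by rwa [hlx]) ?_
    fun_prop
  refine ⟨fun t => ψ (x + t • τ), hγc, by simp [hψx], ?_, ?_⟩
  · have h1 : HasFDerivAt ψ (ContinuousLinearMap.id ℝ (EuclideanSpace ℝ (Fin n)))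
        (x + (0 : ℝ) • τ) := by rwa [hlx]
    exact (h1.comp_hasDerivAt 0 (hasDerivAt_line x τ 0)).deriv
  · have hl : Tendsto (fun t : ℝ => x + t • τ) (𝓝 0) (𝓝 x) := by
      simpa [ContinuousAt] using hline
    have hγx : Tendsto (fun t : ℝ => ψ (x + t • τ)) (𝓝 0) (𝓝 x) := by
      have := hγc.continuousAt.tendsto
      simpa [hψx] using this
    filter_upwards [hl.eventually hright, hγx.eventually (localDefining_eventually h)] with t h1 h2
    refine mem_frontier_of_defining_eq_zero hΩ h2 ?_
    have h3 := congrArg (fun z => inner ℝ ν (z - x)) h1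
    simp only [hΦ, add_sub_cancel_left, real_inner_smul_right, hτ, mul_zero] at h3
    rw [add_sub_right_comm, inner_add_right, real_inner_smul_right, hν1] at h3
    have h4 : a⁻¹ * ρ (ψ (x + t • τ)) = 0 := by linarith
    exact (mul_eq_zero.mp h4).resolve_left (inv_ne_zero ha0)

lemma defining_second_derivative (hρ : ContDiff ℝ ∞ ρ) :
    (∀ y ∈ (univ : Set (EuclideanSpace ℝ (Fin n))),
      HasFDerivWithinAt ρ (fderiv ℝ ρ y) univ y) ∧
      ∀ x, HasFDerivWithinAt (fderiv ℝ ρ) (fderiv ℝ (fderiv ℝ ρ) x) univ x := by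
  refine ⟨fun y _ => (hρ.differentiable (by simp) y).hasFDerivAt.hasFDerivWithinAt, fun x => ?_⟩
  have h1 : ContDiff ℝ ∞ (fderiv ℝ ρ) := hρ.fderiv_right (by simp)
  exact (h1.differentiable (by simp) x).hasFDerivAt.hasFDerivWithinAt

lemma eventually_defining_eq_zero (hΩ : IsOpen Ω) (h : IsLocalDefiningFunction Ω x ρ)
    {γ : ℝ → EuclideanSpace ℝ (Fin n)} (hγ : ContDiffAt ℝ ∞ γ 0) (hγ0 : γ 0 = x)
    (hγf : ∀ᶠ t in 𝓝 0, γ t ∈ frontier Ω) : ∀ᶠ t in 𝓝 0, ρ (γ t) = 0 := by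
  have ht : Tendsto γ (𝓝 0) (𝓝 x) := hγ0 ▸ hγ.continuousAt.tendsto
  filter_upwards [ht.eventually (localDefining_eventually h), hγf] with t h1 h2
  exact defining_eq_zero hΩ h1 h2

/-- The normal acceleration of a boundary curve. -/
lemma inner_levelNormal_deriv_deriv (hΩ : IsOpen Ω) (h : IsLocalDefiningFunction Ω x ρ)
    {γ : ℝ → EuclideanSpace ℝ (Fin n)} (hγ : ContDiffAt ℝ ∞ γ 0) (hγ0 : γ 0 = x)
    (hγf : ∀ᶠ t in 𝓝 0, γ t ∈ frontier Ω) :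
    fderiv ℝ (fderiv ℝ ρ) x (deriv γ 0) (deriv γ 0) / ‖gradient ρ x‖ =
      -inner ℝ (levelNormal ρ x) (deriv (deriv γ) 0) := by
  obtain ⟨h1, h2⟩ := defining_second_derivative h.1
  have := (second_derivative_along_curve h1 (h2 (γ 0)) hγ (Eventually.of_forall fun _ => mem_univ _)
    (eventually_defining_eq_zero hΩ h hγ hγ0 hγf)).2
  rw [hγ0, ← inner_gradient_left, gradient_eq_smul_levelNormal h.2.1, real_inner_smul_left] at this
  rw [div_eq_iff (norm_ne_zero_iff.mpr h.2.1)]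
  linarith

/-- Both sides are minus the normal acceleration of one boundary curve with velocity `τ`, a quantity
that knows nothing of the defining function. -/
lemma tangential_hessian_eq (hΩ : IsOpen Ω) (hx : x ∈ frontier Ω)
    (h₁ : IsLocalDefiningFunction Ω x ρ₁) (h₂ : IsLocalDefiningFunction Ω x ρ₂)
    (hτ : inner ℝ (levelNormal ρ₁ x) τ = 0) :
    fderiv ℝ (fderiv ℝ ρ₁) x τ τ / ‖gradient ρ₁ x‖ =
      fderiv ℝ (fderiv ℝ ρ₂) x τ τ / ‖gradient ρ₂ x‖ := by
  obtain ⟨γ, hγ, hγ0, rfl, hγf⟩ := exists_boundary_curve hΩ hx h₁ hτ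
  rw [inner_levelNormal_deriv_deriv hΩ h₁ hγ hγ0 hγf, inner_levelNormal_deriv_deriv hΩ h₂ hγ hγ0 hγf,
    levelNormal_eq hΩ hx h₁ h₂]

end BoundaryCurves

/-! ### Mean curvature of the boundary -/

section MeanCurvature

lemma sum_bilinear_eq {E ι κ : Type*} [NormedAddCommGroup E] [InnerProductSpace ℝ E]
    [FiniteDimensional ℝ E] [Fintype ι] [Fintype κ] (A : E →L[ℝ] E →L[ℝ] ℝ)
    (b : OrthonormalBasis ι ℝ E) (b' : OrthonormalBasis κ ℝ E) :
    ∑ i, A (b i) (b i) = ∑ i, A (b' i) (b' i) := by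
  have : CompleteSpace E := FiniteDimensional.complete ℝ E
  set T : E →ₗ[ℝ] E :=
    { toFun := fun v => (InnerProductSpace.toDual ℝ E).symm (A v)
      map_add' := by simp
      map_smul' := by simp } with hT
  have hA : ∀ v, A v v = inner ℝ v (T v) := fun v => by
    rw [real_inner_comm]
    simp [hT]
  simp_rw [hA]
  rw [← LinearMap.trace_eq_sum_inner, ← LinearMap.trace_eq_sum_inner]

variable {m : ℕ} {Ω : Set (EuclideanSpace ℝ (Fin (m + 1)))}
  {ρ : EuclideanSpace ℝ (Fin (m + 1)) → ℝ} {x : EuclideanSpace ℝ (Fin (m + 1))}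

/-- The trace of the Hessian may be taken in a basis that starts with the normal; the subtracted
normal term then cancels, leaving the tangential Hessian only. -/
lemma levelSetMeanCurvature_eq_sum
    {b : OrthonormalBasis (Fin (m + 1)) ℝ (EuclideanSpace ℝ (Fin (m + 1)))}
    (hb : b 0 = levelNormal ρ x) :
    levelSetMeanCurvature ρ x = (∑ i : Fin m,
      fderiv ℝ (fderiv ℝ ρ) x (b i.succ) (b i.succ) / ‖gradient ρ x‖) / m := by
  have h1 := sum_bilinear_eq (fderiv ℝ (fderiv ℝ ρ) x) (EuclideanSpace.basisFun (Fin (m + 1)) ℝ) b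
  simp only [EuclideanSpace.basisFun_apply] at h1
  rw [levelSetMeanCurvature, h1, Fin.sum_univ_succ, hb, ← Finset.sum_div, div_div]
  simp only [levelNormal, add_sub_cancel_left, Nat.cast_add, Nat.cast_one, add_sub_cancel_right]
  rw [mul_comm]

lemma exists_basis_levelNormal (h : gradient ρ x ≠ 0) :
    ∃ b : OrthonormalBasis (Fin (m + 1)) ℝ (EuclideanSpace ℝ (Fin (m + 1))),
      b 0 = levelNormal ρ x :=
  exists_orthonormalBasis_zero (by simp) (norm_levelNormal h)

lemma boundaryMeanCurvature_eq (hΩ : IsOpen Ω) (hx : x ∈ frontier Ω)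
    (h : IsLocalDefiningFunction Ω x ρ) :
    boundaryMeanCurvature Ω x = levelSetMeanCurvature ρ x := by
  have hex : ∃ ρ, IsLocalDefiningFunction Ω x ρ := ⟨ρ, h⟩
  rw [boundaryMeanCurvature, dif_pos hex]
  obtain ⟨b, hb⟩ := exists_basis_levelNormal h.2.1
  rw [levelSetMeanCurvature_eq_sum hb,
    levelSetMeanCurvature_eq_sum (hb.trans (levelNormal_eq hΩ hx h hex.choose_spec))]
  congr 1
  refine Finset.sum_congr rfl fun i _ => (tangential_hessian_eq hΩ hx h hex.choose_spec ?_).symm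
  rw [← hb]
  exact b.orthonormal.2 (Fin.succ_ne_zero i).symm

lemma continuousAt_levelSetMeanCurvature (hm : m ≠ 0) (h : ContDiff ℝ ∞ ρ) (hx : gradient ρ x ≠ 0) :
    ContinuousAt (levelSetMeanCurvature ρ) x := by
  have h2 : Continuous (fderiv ℝ (fderiv ℝ ρ)) :=
    ((h.fderiv_right (m := ∞) (by simp)).fderiv_right (m := ∞) (by simp)).continuous
  have hν := continuousAt_levelNormal h hx
  have hg := (contDiff_gradient h).continuous.continuousAt (x := x)
  refine ContinuousAt.div (ContinuousAt.sub ?_ ?_) (continuousAt_const.mul hg.norm) ?_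
  · exact tendsto_finsetSum _ fun i _ =>
      (h2.continuousAt.clm_apply continuousAt_const).clm_apply continuousAt_const
  · exact (h2.continuousAt.clm_apply hν).clm_apply hν
  · simpa using ⟨hm, hx⟩

lemma continuousOn_boundaryMeanCurvature (hm : m ≠ 0) (hΩ : IsOpen Ω) (hs : HasSmoothBoundary Ω) :
    ContinuousOn (boundaryMeanCurvature Ω) (frontier Ω) := by
  intro x hx
  obtain ⟨ρ, hρ⟩ := hs x hx
  refine (continuousAt_levelSetMeanCurvature hm hρ.1 hρ.2.1).continuousWithinAt.congr_of_eventuallyEq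
    ?_ (boundaryMeanCurvature_eq hΩ hx hρ)
  filter_upwards [nhdsWithin_le_nhds (localDefining_eventually hρ), self_mem_nhdsWithin]
    with y hy hyf
  exact boundaryMeanCurvature_eq hΩ hyf hy

end MeanCurvature

/-! ### Boundary derivatives of a function constant on the boundary -/

section BoundaryIdentity

variable {m : ℕ} {Ω : Set (EuclideanSpace ℝ (Fin (m + 1)))}
  {u : EuclideanSpace ℝ (Fin (m + 1)) → ℝ} {c : ℝ}
  {ρ : EuclideanSpace ℝ (Fin (m + 1)) → ℝ} {x τ : EuclideanSpace ℝ (Fin (m + 1))}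

lemma contDiffOn_gradientWithin {E : Type*} [NormedAddCommGroup E] [InnerProductSpace ℝ E]
    [CompleteSpace E] {u : E → ℝ} {s : Set E} (hs : UniqueDiffOn ℝ s) (hu : ContDiffOn ℝ ∞ u s) :
    ContDiffOn ℝ ∞ (gradientWithin u s) s :=
  (InnerProductSpace.toDual ℝ E).symm.contDiff.comp_contDiffOn
    (hu.fderivWithin hs (m := ∞) (by simp))

/-- First and second tangential derivatives of a function which is constant on the boundary. -/
lemma tangential_derivatives_of_const (hΩ : IsOpen Ω) (hs : HasSmoothBoundary Ω)
    (hu : ContDiffOn ℝ ∞ u (closure Ω)) (hc : ∀ x ∈ frontier Ω, u x = c) (hx : x ∈ frontier Ω)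
    (h : IsLocalDefiningFunction Ω x ρ) :
    gradientWithin u (closure Ω) x =
        inner ℝ (gradientWithin u (closure Ω) x) (levelNormal ρ x) • levelNormal ρ x ∧
      ∀ τ, inner ℝ (levelNormal ρ x) τ = 0 →
        inner ℝ (fderivWithin ℝ (gradientWithin u (closure Ω)) (closure Ω) x τ) τ =
          inner ℝ (gradientWithin u (closure Ω) x) (levelNormal ρ x) *
            (fderiv ℝ (fderiv ℝ ρ) x τ τ / ‖gradient ρ x‖) := by
  set s := closure Ω with hsdef
  set G := gradientWithin u s with hG
  set ν := levelNormal ρ x with hν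
  have hsu : UniqueDiffOn ℝ s := uniqueDiffOn_closure hΩ hs
  have hxs : x ∈ s := frontier_subset_closure hx
  have hGc : ContDiffOn ℝ ∞ G s := contDiffOn_gradientWithin hsu hu
  have hGd : HasFDerivWithinAt G (fderivWithin ℝ G s x) s x :=
    (hGc.differentiableOn (by simp) x hxs).hasFDerivWithinAt
  have hf : ∀ y ∈ s, HasFDerivWithinAt u (innerSL ℝ (G y)) s y := fun y hy =>
    ((hu.differentiableOn (by simp) y hy).hasGradientWithinAt).hasFDerivWithinAt
  have hf' : HasFDerivWithinAt (fun y => innerSL ℝ (G y))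
      ((innerSL ℝ).comp (fderivWithin ℝ G s x)) s x :=
    (innerSL ℝ (E := EuclideanSpace ℝ (Fin (m + 1)))).hasFDerivAt.comp_hasFDerivWithinAt x hGd
  -- Along one boundary curve with velocity `τ` and acceleration `w`, the second-order relations for
  -- `u` and for `ρ` are compared. As `G x` is normal, only `⟨ν, w⟩` enters, and it can be
  -- eliminated.
  have key : ∀ τ, inner ℝ ν τ = 0 → ∃ w, inner ℝ (G x) τ = 0 ∧
      inner ℝ (fderivWithin ℝ G s x τ) τ + inner ℝ (G x) w = 0 ∧
      fderiv ℝ (fderiv ℝ ρ) x τ τ / ‖gradient ρ x‖ = -inner ℝ ν w := by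
    intro τ hτ
    obtain ⟨γ, hγ, hγ0, rfl, hγf⟩ := exists_boundary_curve hΩ hx h hτ
    have h2 := second_derivative_along_curve hf (by rw [hγ0]; exact hf') hγ
      (hγf.mono fun t ht => frontier_subset_closure ht) (hγf.mono fun t ht => hc _ ht)
    rw [hγ0] at h2
    exact ⟨_, h2.1, h2.2, inner_levelNormal_deriv_deriv hΩ h hγ hγ0 hγf⟩
  have hpar : G x = inner ℝ (G x) ν • ν := by
    have hν1 : inner ℝ ν ν = 1 := by
      rw [real_inner_self_eq_norm_sq, norm_levelNormal h.2.1, one_pow]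
    have horth : inner ℝ ν (G x - inner ℝ (G x) ν • ν) = 0 := by
      rw [inner_sub_right, real_inner_smul_right, hν1, real_inner_comm]; ring
    obtain ⟨-, h1, -⟩ := key _ horth
    refine sub_eq_zero.mp (inner_self_eq_zero (𝕜 := ℝ).mp ?_)
    rw [inner_sub_left, h1, real_inner_smul_left, horth, mul_zero, sub_zero]
  refine ⟨hpar, fun τ hτ => ?_⟩
  obtain ⟨w, -, h1, h2⟩ := key τ hτ
  rw [h2]
  have h3 : inner ℝ (G x) w = inner ℝ (G x) ν * inner ℝ ν w := by
    conv_lhs => rw [hpar]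
    rw [real_inner_smul_left]
  linarith

/-- The tangential part of the divergence of `a Du` on the boundary. -/
lemma sum_tangential_derivative (hm : m ≠ 0) (hΩ : IsOpen Ω) (hs : HasSmoothBoundary Ω)
    (hu : ContDiffOn ℝ ∞ u (closure Ω)) (hc : ∀ x ∈ frontier Ω, u x = c) (hx : x ∈ frontier Ω)
    (h : IsLocalDefiningFunction Ω x ρ) {a : EuclideanSpace ℝ (Fin (m + 1)) → ℝ}
    (ha : ContDiffOn ℝ ∞ a (closure Ω))
    {b : OrthonormalBasis (Fin (m + 1)) ℝ (EuclideanSpace ℝ (Fin (m + 1)))}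
    (hb : b 0 = levelNormal ρ x) :
    ∑ i : Fin m, inner ℝ (b i.succ) (fderivWithin ℝ
        (fun y => a y • gradientWithin u (closure Ω) y) (closure Ω) x (b i.succ)) =
      m * boundaryMeanCurvature Ω x *
        inner ℝ (a x • gradientWithin u (closure Ω) x) (levelNormal ρ x) := by
  obtain ⟨hpar, htan⟩ := tangential_derivatives_of_const hΩ hs hu hc hx h
  set s := closure Ω
  set G := gradientWithin u s
  have hsu : UniqueDiffOn ℝ s := uniqueDiffOn_closure hΩ hs
  have hxs : x ∈ s := frontier_subset_closure hx
  have hGc : ContDiffOn ℝ ∞ G s := contDiffOn_gradientWithin hsu hu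
  have hd := ((ha.differentiableOn (by simp) x hxs).hasFDerivWithinAt.fun_smul
    (hGc.differentiableOn (by simp) x hxs).hasFDerivWithinAt).fderivWithin (hsu x hxs)
  rw [hd, boundaryMeanCurvature_eq hΩ hx h, levelSetMeanCurvature_eq_sum hb,
    mul_div_cancel₀ _ (by exact_mod_cast hm), Finset.sum_mul]
  refine Finset.sum_congr rfl fun i _ => ?_
  have hi : inner ℝ (levelNormal ρ x) (b i.succ) = 0 := by
    rw [← hb]
    exact b.orthonormal.2 (Fin.succ_ne_zero i).symm
  have h1 := htan _ hi
  -- The term with the derivative of `a` points along the normal vector `G x`, so it drops out of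
  -- the tangential trace.
  have h2 : inner ℝ (b i.succ) (G x) = 0 := by
    rw [hpar, real_inner_smul_right, real_inner_comm _ (b i.succ), hi, mul_zero]
  simp only [add_apply, smul_apply, ContinuousLinearMap.smulRight_apply]
  rw [inner_add_right, real_inner_smul_right, real_inner_smul_right, h2, real_inner_comm, h1,
    real_inner_smul_left]
  ring

end BoundaryIdentity

/-! ### Matrix facts for the induced metric -/

section MatrixLemmas

variable {ι : Type*} [Fintype ι] [DecidableEq ι]

-- Writing `P = Bᵀ B` and cycling the trace gives `tr(N Nᵀ)` with `N = B k Bᵀ` symmetric. It applies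
-- to shape operators, which are self-adjoint for the induced metric though not symmetric as
-- matrices.
open scoped MatrixOrder Matrix.Norms.L2Operator in
lemma trace_mul_self_nonneg {P k : Matrix ι ι ℝ} (hP : P.PosSemidef) (hk : k.IsSymm) :
    0 ≤ (P * k * (P * k)).trace := by
  obtain ⟨B, rfl⟩ : ∃ B : Matrix ι ι ℝ, P = B.conjTranspose * B :=
    CStarAlgebra.nonneg_iff_eq_star_mul_self.mp (Matrix.nonneg_iff_posSemidef.mpr hP)
  set N := B * k * B.conjTranspose with hN
  have hNs : N.conjTranspose = N := by
    rw [hN, Matrix.conjTranspose_mul, Matrix.conjTranspose_mul, Matrix.conjTranspose_conjTranspose,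
      Matrix.conjTranspose_eq_transpose_of_trivial k, hk.eq, Matrix.mul_assoc]
  have h1 : (B.conjTranspose * B * k * (B.conjTranspose * B * k)).trace =
      (N * N.conjTranspose).trace := by
    rw [hNs, hN]
    simp only [Matrix.mul_assoc]
    rw [Matrix.trace_mul_comm]
    simp only [Matrix.mul_assoc]
  rw [h1]
  exact (Matrix.posSemidef_self_mul_conjTranspose N).trace_nonneg

lemma posSemidef_one_add_vecMulVec (a : ℝ) (ha : 0 ≤ a) (v : ι → ℝ) :
    (1 + a • Matrix.vecMulVec v v).PosSemidef := by
  refine Matrix.PosSemidef.one.add (Matrix.PosSemidef.smul ?_ ha)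
  simpa using Matrix.posSemidef_vecMulVec_self_star v

/-- Sherman–Morrison; with `v = Du` and `a = w⁻²` it inverts the induced metric. -/
lemma one_add_vecMulVec_mul (a : ℝ) (v : ι → ℝ) (h : a * (1 - v ⬝ᵥ v) = 1) :
    (1 + a • Matrix.vecMulVec v v) * (1 - Matrix.vecMulVec v v) = 1 := by
  rw [Matrix.add_mul, Matrix.mul_sub, Matrix.mul_sub, Matrix.one_mul, Matrix.mul_one,
    Matrix.one_mul, Matrix.smul_mul, Matrix.vecMulVec_mul_vecMulVec, Matrix.vecMulVec_smul,
    smul_smul]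
  have : a - a * (v ⬝ᵥ v) - 1 = 0 := by linarith
  rw [← sub_eq_zero]
  have h2 : (1 : Matrix ι ι ℝ) - Matrix.vecMulVec v v + (a • Matrix.vecMulVec v v -
      (a * (v ⬝ᵥ v)) • Matrix.vecMulVec v v) - 1 =
      (a - a * (v ⬝ᵥ v) - 1) • Matrix.vecMulVec v v := by
    module
  rw [h2, this, zero_smul]

end MatrixLemmas

/-! ### The shape operator as the Jacobian of `Du / w` -/

section Interior

variable {n : ℕ} {Ω : Set (EuclideanSpace ℝ (Fin n))} {u : EuclideanSpace ℝ (Fin n) → ℝ}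
  {x : EuclideanSpace ℝ (Fin n)}

/-- The field `Du / w`. -/
noncomputable def gradientField (Ω : Set (EuclideanSpace ℝ (Fin n)))
    (u : EuclideanSpace ℝ (Fin n) → ℝ) (x : EuclideanSpace ℝ (Fin n)) : EuclideanSpace ℝ (Fin n) :=
  (graphW Ω u x)⁻¹ • graphGradient Ω u x

/-- The Jacobian matrix of a vector field, up to the boundary of `Ω`. -/
noncomputable def jacobian (Ω : Set (EuclideanSpace ℝ (Fin n)))
    (V : EuclideanSpace ℝ (Fin n) → EuclideanSpace ℝ (Fin n)) (x : EuclideanSpace ℝ (Fin n)) :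
    Matrix (Fin n) (Fin n) ℝ :=
  Matrix.of fun i j => fderivWithin ℝ V (closure Ω) x (EuclideanSpace.single j 1) i

lemma fderivWithin_closure_eq {F : Type*} [NormedAddCommGroup F] [NormedSpace ℝ F] (hΩ : IsOpen Ω)
    (hx : x ∈ Ω) (f : EuclideanSpace ℝ (Fin n) → F) :
    fderivWithin ℝ f (closure Ω) x = fderiv ℝ f x :=
  fderivWithin_of_mem_nhds (mem_of_superset (hΩ.mem_nhds hx) subset_closure)

lemma closure_mem_nhds (hΩ : IsOpen Ω) (hx : x ∈ Ω) : closure Ω ∈ 𝓝 x :=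
  mem_of_superset (hΩ.mem_nhds hx) subset_closure

lemma graphW_pos (h : ‖graphGradient Ω u x‖ < 1) : 0 < graphW Ω u x := by
  rw [graphW, Real.sqrt_pos]
  have := norm_nonneg (graphGradient Ω u x)
  nlinarith

lemma graphW_sq (h : ‖graphGradient Ω u x‖ < 1) :
    graphW Ω u x ^ 2 = 1 - ‖graphGradient Ω u x‖ ^ 2 := by
  refine Real.sq_sqrt ?_
  have := norm_nonneg (graphGradient Ω u x)
  nlinarith

lemma contDiffOn_inv_graphW (hu : UniqueDiffOn ℝ (closure Ω)) (hc : ContDiffOn ℝ ∞ u (closure Ω))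
    (hsp : ∀ x ∈ closure Ω, ‖graphGradient Ω u x‖ < 1) :
    ContDiffOn ℝ ∞ (fun x => (graphW Ω u x)⁻¹) (closure Ω) := by
  have hG : ContDiffOn ℝ ∞ (graphGradient Ω u) (closure Ω) := contDiffOn_gradientWithin hu hc
  have h1 : ContDiffOn ℝ ∞ (fun x => 1 - ‖graphGradient Ω u x‖ ^ 2) (closure Ω) :=
    contDiffOn_const.sub (hG.norm_sq ℝ)
  refine (h1.sqrt fun x hx => ?_).inv fun x hx => (graphW_pos (hsp x hx)).ne'
  rw [← graphW_sq (hsp x hx)]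
  exact pow_ne_zero _ (graphW_pos (hsp x hx)).ne'

lemma contDiffOn_gradientField (hu : UniqueDiffOn ℝ (closure Ω))
    (hc : ContDiffOn ℝ ∞ u (closure Ω)) (hsp : ∀ x ∈ closure Ω, ‖graphGradient Ω u x‖ < 1) :
    ContDiffOn ℝ ∞ (gradientField Ω u) (closure Ω) :=
  (contDiffOn_inv_graphW hu hc hsp).smul (contDiffOn_gradientWithin hu hc)

lemma inv_graphW_sq (h : ‖graphGradient Ω u x‖ < 1) :
    (graphW Ω u x)⁻¹ ^ 2 = 1 + ‖gradientField Ω u x‖ ^ 2 := by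
  have h1 := graphW_pos h
  have h2 := graphW_sq h
  rw [gradientField, norm_smul, mul_pow, norm_inv, Real.norm_of_nonneg h1.le]
  field_simp
  linarith

/-- Differentiate `w⁻² = 1 + |V|²` and divide by `2 w⁻¹`, using `Du = w V`. -/
lemma fderiv_inv_graphW (hΩ : IsOpen Ω) (hu : UniqueDiffOn ℝ (closure Ω))
    (hc : ContDiffOn ℝ ∞ u (closure Ω)) (hsp : ∀ x ∈ closure Ω, ‖graphGradient Ω u x‖ < 1)
    (hx : x ∈ Ω) (v : EuclideanSpace ℝ (Fin n)) :
    fderiv ℝ (fun y => (graphW Ω u y)⁻¹) x v =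
      inner ℝ (graphGradient Ω u x) (fderiv ℝ (gradientField Ω u) x v) := by
  have hn := closure_mem_nhds hΩ hx
  have hp := ((contDiffOn_inv_graphW hu hc hsp).contDiffAt hn).differentiableAt (by simp)
  have hV := ((contDiffOn_gradientField hu hc hsp).contDiffAt hn).differentiableAt (by simp)
  have h1 := (hp.hasFDerivAt.pow 2).congr_of_eventuallyEq
    (f₁ := fun y => 1 + ‖gradientField Ω u y‖ ^ 2) (by
      filter_upwards [hn] with y hy
      exact (inv_graphW_sq (hsp y hy)).symm)
  have h2 := hV.hasFDerivAt.norm_sq.const_add 1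
  have h3 := congrArg (fun L => L v) (h1.unique h2)
  have hW := graphW_pos (hsp x (subset_closure hx))
  have hG : graphGradient Ω u x = graphW Ω u x • gradientField Ω u x := by
    rw [gradientField, smul_smul, mul_inv_cancel₀ hW.ne', one_smul]
  simp only [nsmul_eq_mul, Nat.cast_ofNat, smul_apply, ContinuousLinearMap.comp_apply,
    innerSL_apply_apply, smul_eq_mul, Nat.add_one_sub_one, pow_one, mul_assoc] at h3
  have h4 := mul_left_cancel₀ two_ne_zero h3
  rw [hG, real_inner_smul_left, ← h4, mul_inv_cancel_left₀ hW.ne']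

lemma inner_fderiv_graphGradient_symm (hΩ : IsOpen Ω) (hc : ContDiffOn ℝ ∞ u (closure Ω))
    (hx : x ∈ Ω) (v w : EuclideanSpace ℝ (Fin n)) :
    inner ℝ w (fderiv ℝ (graphGradient Ω u) x v) =
      inner ℝ v (fderiv ℝ (graphGradient Ω u) x w) := by
  have hn := closure_mem_nhds hΩ hx
  have hcx := hc.contDiffAt hn
  have hev : graphGradient Ω u =ᶠ[𝓝 x] fun y =>
      (InnerProductSpace.toDual ℝ (EuclideanSpace ℝ (Fin n))).symm (fderiv ℝ u y) := by
    filter_upwards [hΩ.mem_nhds hx] with y hy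
    rw [graphGradient, gradientWithin, fderivWithin_closure_eq hΩ hy]
  have hd : DifferentiableAt ℝ (fderiv ℝ u) x :=
    (hcx.fderiv_right (m := 1) (by norm_cast)).differentiableAt (by simp)
  have h1 : ∀ v w, inner ℝ w (fderiv ℝ (graphGradient Ω u) x v) = fderiv ℝ (fderiv ℝ u) x v w := by
    intro v w
    have := ((InnerProductSpace.toDual ℝ (EuclideanSpace ℝ
      (Fin n))).symm.toContinuousLinearEquiv.toContinuousLinearMap.hasFDerivAt.comp x
        hd.hasFDerivAt).congr_of_eventuallyEq hev
    rw [this.fderiv, real_inner_comm]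
    simp
  have hsymm : IsSymmSndFDerivAt ℝ u x := hcx.isSymmSndFDerivAt (by rw [minSmoothness_of_isRCLikeNormedField]; norm_cast)
  rw [h1, h1, hsymm.eq]

lemma graphMetric_eq : graphMetric Ω u x =
    1 - Matrix.vecMulVec (graphGradient Ω u x).ofLp (graphGradient Ω u x).ofLp := by
  ext i j
  simp [graphMetric, lorentz, graphTangent, Matrix.vecMulVec_apply, Matrix.one_apply,
    EuclideanSpace.inner_single_left]

lemma graphSecondForm_apply (hΩ : IsOpen Ω) (hu : UniqueDiffOn ℝ (closure Ω))
    (hc : ContDiffOn ℝ ∞ u (closure Ω)) (hsp : ∀ x ∈ closure Ω, ‖graphGradient Ω u x‖ < 1)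
    (hx : x ∈ Ω) (i j : Fin n) :
    graphSecondForm Ω u x i j =
      fderiv ℝ (gradientField Ω u) x (EuclideanSpace.single j 1) i - graphGradient Ω u x i *
        fderiv ℝ (fun y => (graphW Ω u y)⁻¹) x (EuclideanSpace.single j 1) := by
  have hn := closure_mem_nhds hΩ hx
  have hp := ((contDiffOn_inv_graphW hu hc hsp).contDiffAt hn).differentiableAt (by simp)
  have hV := ((contDiffOn_gradientField hu hc hsp).contDiffAt hn).differentiableAt (by simp)
  have hN : graphNormal Ω u = fun y => (gradientField Ω u y, (graphW Ω u y)⁻¹) := by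
    funext y
    simp [graphNormal, gradientField]
  have hd := (hV.hasFDerivAt.prodMk hp.hasFDerivAt).fderiv
  rw [graphSecondForm, Matrix.of_apply, hN, hd]
  simp [lorentz, graphTangent, EuclideanSpace.inner_single_left]

/-- The second fundamental form is `D²u / w`; in particular it is symmetric. -/
lemma graphSecondForm_isSymm (hΩ : IsOpen Ω) (hu : UniqueDiffOn ℝ (closure Ω))
    (hc : ContDiffOn ℝ ∞ u (closure Ω)) (hsp : ∀ x ∈ closure Ω, ‖graphGradient Ω u x‖ < 1)
    (hx : x ∈ Ω) : (graphSecondForm Ω u x).IsSymm := by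
  have hn := closure_mem_nhds hΩ hx
  have hp := ((contDiffOn_inv_graphW hu hc hsp).contDiffAt hn).differentiableAt (by simp)
  have hG : DifferentiableAt ℝ (graphGradient Ω u) x :=
    ((contDiffOn_gradientWithin hu hc).contDiffAt hn).differentiableAt (by simp)
  have hd : fderiv ℝ (gradientField Ω u) x = _ := (hp.hasFDerivAt.fun_smul hG.hasFDerivAt).fderiv
  have key : ∀ i j, graphSecondForm Ω u x i j = (graphW Ω u x)⁻¹ *
      inner ℝ (EuclideanSpace.single i 1)
        (fderiv ℝ (graphGradient Ω u) x (EuclideanSpace.single j 1)) := by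
    intro i j
    rw [graphSecondForm_apply hΩ hu hc hsp hx, hd]
    simp [EuclideanSpace.inner_single_left]
    ring
  ext i j
  rw [Matrix.transpose_apply, key, key, inner_fderiv_graphGradient_symm hΩ hc hx]

lemma graphMetric_left_inverse (h : ‖graphGradient Ω u x‖ < 1) :
    (1 + (graphW Ω u x)⁻¹ ^ 2 • Matrix.vecMulVec (graphGradient Ω u x).ofLp
      (graphGradient Ω u x).ofLp) * graphMetric Ω u x = 1 := by
  rw [graphMetric_eq]
  refine one_add_vecMulVec_mul _ _ ?_
  have h1 : (graphGradient Ω u x).ofLp ⬝ᵥ (graphGradient Ω u x).ofLp = ‖graphGradient Ω u x‖ ^ 2 := by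
    rw [EuclideanSpace.norm_sq_eq]
    simp [dotProduct, sq]
  rw [h1, ← graphW_sq h, ← mul_pow, inv_mul_cancel₀ (graphW_pos h).ne', one_pow]

/-- The normal is `(V, w⁻¹)`, so `h = DV - Du ⊗ D(w⁻¹)`. Since `D(w⁻¹)` is `Du` contracted with
`DV`, this is `(1 - Du ⊗ Du) DV = g DV`. -/
lemma shapeOperator_eq_jacobian (hΩ : IsOpen Ω) (hu : UniqueDiffOn ℝ (closure Ω))
    (hc : ContDiffOn ℝ ∞ u (closure Ω)) (hsp : ∀ x ∈ closure Ω, ‖graphGradient Ω u x‖ < 1)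
    (hx : x ∈ Ω) : shapeOperator Ω u x = jacobian Ω (gradientField Ω u) x := by
  have hsx := hsp x (subset_closure hx)
  have h1 : graphSecondForm Ω u x = graphMetric Ω u x * jacobian Ω (gradientField Ω u) x := by
    ext i j
    rw [graphSecondForm_apply hΩ hu hc hsp hx, fderiv_inv_graphW hΩ hu hc hsp hx, graphMetric_eq,
      Matrix.sub_mul, Matrix.one_mul, Matrix.vecMulVec_mul, Matrix.sub_apply,
      Matrix.vecMulVec_apply]
    simp only [jacobian, Matrix.of_apply, fderivWithin_closure_eq hΩ hx]
    congr 2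
    rw [PiLp.inner_apply]
    simp [Matrix.vecMul, dotProduct, mul_comm]
  rw [shapeOperator, Matrix.inv_eq_left_inv (graphMetric_left_inverse hsx), h1, ← Matrix.mul_assoc,
    graphMetric_left_inverse hsx, Matrix.one_mul]

lemma trace_traceFreeShape_sq_nonneg (hΩ : IsOpen Ω) (hu : UniqueDiffOn ℝ (closure Ω))
    (hc : ContDiffOn ℝ ∞ u (closure Ω)) (hsp : ∀ x ∈ closure Ω, ‖graphGradient Ω u x‖ < 1)
    (hx : x ∈ Ω) : 0 ≤ (traceFreeShape Ω u x * traceFreeShape Ω u x).trace := by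
  have hinv := graphMetric_left_inverse (hsp x (subset_closure hx))
  set P := 1 + (graphW Ω u x)⁻¹ ^ 2 • Matrix.vecMulVec (graphGradient Ω u x).ofLp
      (graphGradient Ω u x).ofLp with hP
  have hg : (graphMetric Ω u x).IsSymm := by
    rw [graphMetric_eq, Matrix.IsSymm, Matrix.transpose_sub, Matrix.transpose_one,
      Matrix.transpose_vecMulVec]
  have h1 : traceFreeShape Ω u x =
      P * (graphSecondForm Ω u x - (graphMeanCurvature Ω u x / n) • graphMetric Ω u x) := by
    rw [Matrix.mul_sub, Matrix.mul_smul, hinv, traceFreeShape, shapeOperator,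
      Matrix.inv_eq_left_inv hinv]
  rw [h1]
  exact trace_mul_self_nonneg (posSemidef_one_add_vecMulVec _ (by positivity) _)
    ((graphSecondForm_isSymm hΩ hu hc hsp hx).sub (hg.smul _))

end Interior

/-! ### Divergence of the convective derivative -/

section Divergence

variable {n : ℕ} {Ω : Set (EuclideanSpace ℝ (Fin n))}
  {V : EuclideanSpace ℝ (Fin n) → EuclideanSpace ℝ (Fin n)} {x : EuclideanSpace ℝ (Fin n)}

lemma trace_jacobian : (jacobian Ω V x).trace =
    ∑ i, fderivWithin ℝ V (closure Ω) x (EuclideanSpace.single i 1) i := rfl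

lemma trace_jacobian_sq : (jacobian Ω V x * jacobian Ω V x).trace =
    ∑ i, fderivWithin ℝ V (closure Ω) x
      (fderivWithin ℝ V (closure Ω) x (EuclideanSpace.single i 1)) i := by
  set L := fderivWithin ℝ V (closure Ω) x
  refine Finset.sum_congr rfl fun i _ => ?_
  rw [Matrix.diag_apply, Matrix.mul_apply]
  have h : L (EuclideanSpace.single i 1) =
      ∑ j, L (EuclideanSpace.single i 1) j • EuclideanSpace.single j (1 : ℝ) := by
    conv_lhs => rw [← (EuclideanSpace.basisFun (Fin n) ℝ).sum_repr (L (EuclideanSpace.single i 1))]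
    simp
  conv_rhs => rw [h]
  simp [jacobian, L, mul_comm]

/-- If `div V` is constant, then `div (D_V V) = tr ((DV)²)`. -/
lemma divergence_convective_derivative (hΩ : IsOpen Ω) (hV : ContDiffOn ℝ ∞ V (closure Ω)) {c : ℝ}
    (hc : ∀ x ∈ Ω, (jacobian Ω V x).trace = c) (hx : x ∈ Ω) :
    ∑ i, fderiv ℝ (fun y => fderivWithin ℝ V (closure Ω) y (V y)) x (EuclideanSpace.single i 1) i =
      (jacobian Ω V x * jacobian Ω V x).trace := by
  have hVx := hV.contDiffAt (closure_mem_nhds hΩ hx)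
  have hd : DifferentiableAt ℝ V x := hVx.differentiableAt (by simp)
  have hd2 : DifferentiableAt ℝ (fderiv ℝ V) x :=
    (hVx.fderiv_right (m := 1) (by norm_cast)).differentiableAt (by simp)
  have hev : (fun y => fderivWithin ℝ V (closure Ω) y (V y)) =ᶠ[𝓝 x] fun y => fderiv ℝ V y (V y) := by
    filter_upwards [hΩ.mem_nhds hx] with y hy
    rw [fderivWithin_closure_eq hΩ hy]
  have hsymm : IsSymmSndFDerivAt ℝ V x := hVx.isSymmSndFDerivAt (by rw [minSmoothness_of_isRCLikeNormedField]; norm_cast)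
  -- The derivative of the constant `div V`. After swapping the order of differentiation it is the
  -- second-order part of `div (D_V V)`.
  have hconst : ∀ v, ∑ i, fderiv ℝ (fderiv ℝ V) x v (EuclideanSpace.single i 1) i = 0 := by
    intro v
    have h1 : HasFDerivAt (fun y => ∑ i, EuclideanSpace.proj (𝕜 := ℝ) i
        (fderiv ℝ V y (EuclideanSpace.single i 1))) (∑ i, (EuclideanSpace.proj (𝕜 := ℝ) i).comp
          ((fderiv ℝ (fderiv ℝ V) x).flip (EuclideanSpace.single i 1))) x := by
      refine HasFDerivAt.fun_sum fun i _ => ?_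
      have h2 := hd2.hasFDerivAt.clm_apply (hasFDerivAt_const (EuclideanSpace.single i (1 : ℝ)) x)
      have h3 := (EuclideanSpace.proj (𝕜 := ℝ) i).hasFDerivAt.comp x h2
      refine h3.congr_fderiv ?_
      ext w
      simp
    have h4 : HasFDerivAt (fun y => ∑ i, EuclideanSpace.proj (𝕜 := ℝ) i
        (fderiv ℝ V y (EuclideanSpace.single i 1))) (0 : EuclideanSpace ℝ (Fin n) →L[ℝ] ℝ) x := by
      refine (hasFDerivAt_const c x).congr_of_eventuallyEq ?_
      filter_upwards [hΩ.mem_nhds hx] with y hy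
      rw [← hc y hy, trace_jacobian, fderivWithin_closure_eq hΩ hy]
      rfl
    have := congrArg (fun L => L v) (h1.unique h4)
    simpa using this
  rw [hev.fderiv_eq, (hd2.hasFDerivAt.clm_apply hd.hasFDerivAt).fderiv, trace_jacobian_sq,
    fderivWithin_closure_eq hΩ hx]
  have hsum := hconst (V x)
  simp_rw [hsymm.eq (V x)] at hsum
  simp [Finset.sum_add_distrib, hsum]

end Divergence

/-! ### The integral identity for the trace-free second fundamental form -/

section IntegralIdentity

variable {m : ℕ} {Ω : Set (EuclideanSpace ℝ (Fin (m + 1)))}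
  {u : EuclideanSpace ℝ (Fin (m + 1)) → ℝ} {c : ℝ} {x : EuclideanSpace ℝ (Fin (m + 1))}

/-- The normal component of `Du / w` on the boundary. -/
noncomputable def normalFlux (Ω : Set (EuclideanSpace ℝ (Fin (m + 1))))
    (u : EuclideanSpace ℝ (Fin (m + 1)) → ℝ) (x : EuclideanSpace ℝ (Fin (m + 1))) : ℝ :=
  inner ℝ (gradientField Ω u x) (outerNormal Ω x)

lemma trace_jacobian_eq_sum_inner {n : ℕ} {Ω : Set (EuclideanSpace ℝ (Fin n))}
    {V : EuclideanSpace ℝ (Fin n) → EuclideanSpace ℝ (Fin n)} {x : EuclideanSpace ℝ (Fin n)}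
    {ι : Type*} [Fintype ι] (b : OrthonormalBasis ι ℝ (EuclideanSpace ℝ (Fin n))) :
    (jacobian Ω V x).trace = ∑ i, inner ℝ (b i) (fderivWithin ℝ V (closure Ω) x (b i)) := by
  have h1 := LinearMap.trace_eq_sum_inner
    (fderivWithin ℝ V (closure Ω) x : EuclideanSpace ℝ (Fin n) →ₗ[ℝ] EuclideanSpace ℝ (Fin n)) b
  have h2 := LinearMap.trace_eq_sum_inner
    (fderivWithin ℝ V (closure Ω) x : EuclideanSpace ℝ (Fin n) →ₗ[ℝ] EuclideanSpace ℝ (Fin n))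
    (EuclideanSpace.basisFun (Fin n) ℝ)
  simp only [ContinuousLinearMap.coe_coe] at h1 h2
  rw [trace_jacobian, ← h1, h2]
  simp [EuclideanSpace.inner_single_left]

lemma continuousOn_jacobian {n : ℕ} {Ω : Set (EuclideanSpace ℝ (Fin n))}
    {V : EuclideanSpace ℝ (Fin n) → EuclideanSpace ℝ (Fin n)} (hu : UniqueDiffOn ℝ (closure Ω))
    (hV : ContDiffOn ℝ ∞ V (closure Ω)) : ContinuousOn (jacobian Ω V) (closure Ω) := by
  have h := hV.continuousOn_fderivWithin hu (by simp)
  refine continuousOn_pi.mpr fun i => continuousOn_pi.mpr fun j => ?_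
  exact (EuclideanSpace.proj (𝕜 := ℝ) i).continuous.comp_continuousOn
    (h.clm_apply continuousOn_const)

lemma gradientField_eq_normalFlux_smul (hΩ : IsOpen Ω) (hs : HasSmoothBoundary Ω)
    (hu : ContDiffOn ℝ ∞ u (closure Ω)) (hc : ∀ x ∈ frontier Ω, u x = c) (hx : x ∈ frontier Ω) :
    gradientField Ω u x = normalFlux Ω u x • outerNormal Ω x := by
  obtain ⟨ρ, hρ⟩ := hs x hx
  have h1 := (tangential_derivatives_of_const hΩ hs hu hc hx hρ).1
  rw [normalFlux, outerNormal_eq hΩ hx hρ, gradientField, real_inner_smul_left, mul_smul]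
  congr 1

/-- The normal component of `D_V V`, where `V = Du / w`, on the boundary. -/
lemma inner_convective_derivative (hm : m ≠ 0) (hΩ : IsOpen Ω) (hs : HasSmoothBoundary Ω)
    (hu : ContDiffOn ℝ ∞ u (closure Ω)) (hsp : ∀ x ∈ closure Ω, ‖graphGradient Ω u x‖ < 1)
    (hc : ∀ x ∈ frontier Ω, u x = c) (hx : x ∈ frontier Ω) :
    inner ℝ (fderivWithin ℝ (gradientField Ω u) (closure Ω) x (gradientField Ω u x))
        (outerNormal Ω x) =
      (jacobian Ω (gradientField Ω u) x).trace * normalFlux Ω u x -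
        m * (boundaryMeanCurvature Ω x * normalFlux Ω u x ^ 2) := by
  obtain ⟨ρ, hρ⟩ := hs x hx
  have hν := outerNormal_eq hΩ hx hρ
  obtain ⟨b, hb⟩ := exists_basis_levelNormal hρ.2.1
  have h1 := sum_tangential_derivative hm hΩ hs hu hc hx hρ
    (contDiffOn_inv_graphW (uniqueDiffOn_closure hΩ hs) hu hsp) hb
  rw [trace_jacobian_eq_sum_inner b, Fin.sum_univ_succ]
  change ∑ i : Fin m, inner ℝ (b i.succ) (fderivWithin ℝ (gradientField Ω u) (closure Ω) x
    (b i.succ)) = m * boundaryMeanCurvature Ω x * inner ℝ (gradientField Ω u x) _ at h1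
  rw [h1, ← hν]
  -- As `V = φ ν`, the left side is `φ` times the normal term of the trace, that is, of `div V`
  -- minus its tangential part.
  conv_lhs => rw [gradientField_eq_normalFlux_smul hΩ hs hu hc hx]
  rw [map_smul, real_inner_smul_left, hb, ← hν, real_inner_comm]
  simp only [normalFlux]
  ring

lemma continuousOn_normalFlux (hΩ : IsOpen Ω) (hs : HasSmoothBoundary Ω)
    (hu : ContDiffOn ℝ ∞ u (closure Ω)) (hsp : ∀ x ∈ closure Ω, ‖graphGradient Ω u x‖ < 1) :
    ContinuousOn (normalFlux Ω u) (frontier Ω) :=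
  ((contDiffOn_gradientField (uniqueDiffOn_closure hΩ hs) hu hsp).continuousOn.mono
    frontier_subset_closure).inner (continuousOn_outerNormal hΩ hs)

/-- The mean curvature equation is given only inside `Ω` but is used on the boundary; `DV` is
continuous up to there. -/
lemma trace_jacobian_eq_on_closure (hΩ : IsOpen Ω) (hs : HasSmoothBoundary Ω)
    (hu : ContDiffOn ℝ ∞ u (closure Ω)) (hsp : ∀ x ∈ closure Ω, ‖graphGradient Ω u x‖ < 1) {k : ℝ}
    (hH : ∀ x ∈ Ω, graphMeanCurvature Ω u x = k) :
    ∀ x ∈ closure Ω, (jacobian Ω (gradientField Ω u) x).trace = k := by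
  have hud := uniqueDiffOn_closure hΩ hs
  have h1 : EqOn (fun x => (jacobian Ω (gradientField Ω u) x).trace) (fun _ => k) Ω := by
    intro x hx
    simp only
    rw [← hH x hx, graphMeanCurvature, shapeOperator_eq_jacobian hΩ hud hu hsp hx]
  have hcont : ContinuousOn (fun x => (jacobian Ω (gradientField Ω u) x).trace) (closure Ω) :=
    (Continuous.matrix_trace continuous_id).comp_continuousOn
      (continuousOn_jacobian hud (contDiffOn_gradientField hud hu hsp))
  exact h1.of_subset_closure hcont continuousOn_const subset_closure le_rfl

lemma traceFreeShape_eq_jacobian (hΩ : IsOpen Ω) (hs : HasSmoothBoundary Ω)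
    (hu : ContDiffOn ℝ ∞ u (closure Ω)) (hsp : ∀ x ∈ closure Ω, ‖graphGradient Ω u x‖ < 1)
    (hH : ∀ x ∈ Ω, graphMeanCurvature Ω u x = (m + 1 : ℕ)) (hx : x ∈ Ω) :
    traceFreeShape Ω u x = jacobian Ω (gradientField Ω u) x - 1 := by
  rw [traceFreeShape, shapeOperator_eq_jacobian hΩ (uniqueDiffOn_closure hΩ hs) hu hsp hx, hH x hx,
    div_self (by positivity), one_smul]

lemma traceFreeNorm_sq (hΩ : IsOpen Ω) (hs : HasSmoothBoundary Ω)
    (hu : ContDiffOn ℝ ∞ u (closure Ω)) (hsp : ∀ x ∈ closure Ω, ‖graphGradient Ω u x‖ < 1)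
    (hH : ∀ x ∈ Ω, graphMeanCurvature Ω u x = (m + 1 : ℕ)) (hx : x ∈ Ω) :
    traceFreeNorm Ω u x ^ 2 =
      (jacobian Ω (gradientField Ω u) x * jacobian Ω (gradientField Ω u) x).trace -
        (m + 1 : ℕ) := by
  rw [traceFreeNorm, Real.sq_sqrt (trace_traceFreeShape_sq_nonneg hΩ (uniqueDiffOn_closure hΩ hs)
    hu hsp hx), traceFreeShape_eq_jacobian hΩ hs hu hsp hH hx, Matrix.sub_mul, Matrix.mul_sub,
    Matrix.mul_one, Matrix.one_mul, Matrix.trace_sub, Matrix.trace_sub, Matrix.trace_sub,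
    trace_jacobian_eq_on_closure hΩ hs hu hsp hH x (subset_closure hx), Matrix.trace_one,
    Fintype.card_fin]
  ring

/-- On `Ω` the norm coincides with an expression in `DV` that is continuous on the compact closure,
hence bounded. -/
lemma memLp_traceFreeNorm (hΩ : IsOpen Ω) (hΩb : Bornology.IsBounded Ω) (hs : HasSmoothBoundary Ω)
    (hu : ContDiffOn ℝ ∞ u (closure Ω)) (hsp : ∀ x ∈ closure Ω, ‖graphGradient Ω u x‖ < 1)
    (hH : ∀ x ∈ Ω, graphMeanCurvature Ω u x = (m + 1 : ℕ)) :
    MemLp (traceFreeNorm Ω u) 2 (volume.restrict Ω) := by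
  have hud := uniqueDiffOn_closure hΩ hs
  set F : EuclideanSpace ℝ (Fin (m + 1)) → ℝ := fun x =>
    √((jacobian Ω (gradientField Ω u) x - 1) * (jacobian Ω (gradientField Ω u) x - 1)).trace with hF
  have hFc : ContinuousOn F (closure Ω) := by
    have hJ := continuousOn_jacobian hud (contDiffOn_gradientField hud hu hsp)
    have h1 : Continuous fun M : Matrix (Fin (m + 1)) (Fin (m + 1)) ℝ =>
        √((M - 1) * (M - 1)).trace :=
      (((continuous_id.sub continuous_const).matrix_mul
        (continuous_id.sub continuous_const)).matrix_trace).sqrt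
    exact h1.comp_continuousOn hJ
  have heq : ∀ x ∈ Ω, F x = traceFreeNorm Ω u x := fun x hx => by
    rw [traceFreeNorm, traceFreeShape_eq_jacobian hΩ hs hu hsp hH hx]
  obtain ⟨C, hC⟩ := hΩb.isCompact_closure.exists_bound_of_continuousOn hFc
  have : IsFiniteMeasure (volume.restrict Ω) := ⟨by
    rw [Measure.restrict_apply_univ]; exact hΩb.measure_lt_top⟩
  refine MemLp.of_bound (C := C) ?_ ?_
  · exact ((hFc.mono subset_closure).congr fun x hx => (heq x hx).symm).aestronglyMeasurable
      hΩ.measurableSet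
  · filter_upwards [ae_restrict_mem hΩ.measurableSet] with x hx
    rw [← heq x hx]
    exact hC x (subset_closure hx)

/-- `θ = -w⁻¹` and `w⁻² = 1 + |V|²`. -/
lemma sqrt_angleFunction (h : ‖graphGradient Ω u x‖ < 1) :
    √(angleFunction Ω u x ^ 2 - 1) = ‖gradientField Ω u x‖ := by
  have h1 : angleFunction Ω u x = -(graphW Ω u x)⁻¹ := by
    simp [angleFunction, lorentz, graphNormal]
  rw [h1, neg_sq, inv_graphW_sq h, add_sub_cancel_left, Real.sqrt_sq (norm_nonneg _)]

/-- The flux of `Du / w` through the boundary. -/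
lemma integral_normalFlux (hΩ : IsOpen Ω) (hΩb : Bornology.IsBounded Ω) (hs : HasSmoothBoundary Ω)
    (hu : ContDiffOn ℝ ∞ u (closure Ω)) (hsp : ∀ x ∈ closure Ω, ‖graphGradient Ω u x‖ < 1)
    (hH : ∀ x ∈ Ω, graphMeanCurvature Ω u x = (m + 1 : ℕ)) :
    ∫ x, normalFlux Ω u x ∂(surfaceMeasure Ω) = (m + 1 : ℕ) * volume.real Ω := by
  have hV := contDiffOn_gradientField (uniqueDiffOn_closure hΩ hs) hu hsp
  have h1 := integral_divergence_eq hΩ hΩb hs (hV.of_le (by simp))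
  simp only [normalFlux]
  rw [← h1, setIntegral_congr_fun (g := fun _ => ((m + 1 : ℕ) : ℝ)) hΩ.measurableSet,
    setIntegral_const, smul_eq_mul, mul_comm]
  intro x hx
  simp only
  rw [← trace_jacobian_eq_on_closure hΩ hs hu hsp hH x (subset_closure hx), trace_jacobian,
    fderivWithin_closure_eq hΩ hx]

/-- The integral identity behind the stability estimates. -/
theorem integral_traceFreeNorm_sq (hm : m ≠ 0) (hΩ : IsOpen Ω) (hΩb : Bornology.IsBounded Ω)
    (hs : HasSmoothBoundary Ω)
    (hu : ContDiffOn ℝ ∞ u (closure Ω)) (hsp : ∀ x ∈ closure Ω, ‖graphGradient Ω u x‖ < 1)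
    (hc : ∀ x ∈ frontier Ω, u x = c) (hH : ∀ x ∈ Ω, graphMeanCurvature Ω u x = (m + 1 : ℕ)) :
    ∫ x in Ω, traceFreeNorm Ω u x ^ 2 =
      m * ((∫ x, normalFlux Ω u x ∂(surfaceMeasure Ω)) -
        ∫ x, boundaryMeanCurvature Ω x * normalFlux Ω u x ^ 2 ∂(surfaceMeasure Ω)) := by
  have hud := uniqueDiffOn_closure hΩ hs
  set V := gradientField Ω u with hVdef
  have hV : ContDiffOn ℝ ∞ V (closure Ω) := contDiffOn_gradientField hud hu hsp
  have htr := trace_jacobian_eq_on_closure hΩ hs hu hsp hH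
  have hX : ContDiffOn ℝ 1 (fun y => fderivWithin ℝ V (closure Ω) y (V y)) (closure Ω) :=
    (hV.fderivWithin hud (m := 1) (by norm_cast)).clm_apply (hV.of_le (by simp))
  have hdiv := integral_divergence_eq hΩ hΩb hs hX
  have hφ := integral_normalFlux hΩ hΩb hs hu hsp hH
  have hφc := continuousOn_normalFlux hΩ hs hu hsp
  have hHφ : ContinuousOn (fun x => boundaryMeanCurvature Ω x * normalFlux Ω u x ^ 2) (frontier Ω) :=
    (continuousOn_boundaryMeanCurvature hm hΩ hs).mul (hφc.pow 2)
  have hφi := integrable_of_continuousOn_frontier hΩ hΩb hs hφc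
  have hHφi := integrable_of_continuousOn_frontier hΩ hΩb hs hHφ
  have h1 : ∫ x in Ω, traceFreeNorm Ω u x ^ 2 =
      (∫ x in Ω, ∑ i, fderiv ℝ (fun y => fderivWithin ℝ V (closure Ω) y (V y)) x
        (EuclideanSpace.single i 1) i) - (m + 1 : ℕ) * volume.real Ω := by
    have hconst : ∫ _ in Ω, ((m + 1 : ℕ) : ℝ) = (m + 1 : ℕ) * volume.real Ω := by
      rw [setIntegral_const, smul_eq_mul, mul_comm]
    have hint : IntegrableOn (fun x => traceFreeNorm Ω u x ^ 2) Ω :=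
      (memLp_traceFreeNorm hΩ hΩb hs hu hsp hH).integrable_sq
    have hci : IntegrableOn (fun _ : EuclideanSpace ℝ (Fin (m + 1)) => ((m + 1 : ℕ) : ℝ)) Ω :=
      integrableOn_const hΩb.measure_lt_top.ne
    rw [eq_sub_iff_add_eq, ← hconst, ← integral_add hint hci]
    refine setIntegral_congr_fun hΩ.measurableSet fun x hx => ?_
    simp only
    rw [traceFreeNorm_sq hΩ hs hu hsp hH hx, sub_add_cancel, divergence_convective_derivative hΩ hV
      (fun y hy => htr y (subset_closure hy)) hx]
  have h2 : ∫ x, inner ℝ (fderivWithin ℝ V (closure Ω) x (V x)) (outerNormal Ω x)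
        ∂(surfaceMeasure Ω) =
      (m + 1 : ℕ) * (∫ x, normalFlux Ω u x ∂(surfaceMeasure Ω)) -
        m * ∫ x, boundaryMeanCurvature Ω x * normalFlux Ω u x ^ 2 ∂(surfaceMeasure Ω) := by
    rw [← integral_const_mul, ← integral_const_mul,
      ← integral_sub (hφi.const_mul _) (hHφi.const_mul _)]
    refine integral_congr_ae (ae_mem_frontier.mono fun x hx => ?_)
    simp only
    rw [inner_convective_derivative hm hΩ hs hu hsp hc hx, htr x (frontier_subset_closure hx)]
  rw [h1, hdiv, h2, ← hφ]
  push_cast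
  ring

lemma lpNorm_traceFreeNorm (hΩ : IsOpen Ω) (hΩb : Bornology.IsBounded Ω) (hs : HasSmoothBoundary Ω)
    (hu : ContDiffOn ℝ ∞ u (closure Ω)) (hsp : ∀ x ∈ closure Ω, ‖graphGradient Ω u x‖ < 1)
    (hH : ∀ x ∈ Ω, graphMeanCurvature Ω u x = (m + 1 : ℕ)) :
    lpNorm (traceFreeNorm Ω u) 2 (volume.restrict Ω) = √(∫ x in Ω, traceFreeNorm Ω u x ^ 2) := by
  rw [lpNorm_eq_integral_norm_rpow_toReal (by simp) (by simp)
    (memLp_traceFreeNorm hΩ hΩb hs hu hsp hH).aestronglyMeasurable, Real.sqrt_eq_rpow]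
  simp

lemma fderiv_gradientField_apply {n : ℕ} {Ω : Set (EuclideanSpace ℝ (Fin n))}
    {u : EuclideanSpace ℝ (Fin n) → ℝ} {x : EuclideanSpace ℝ (Fin n)}
    (hV : DifferentiableAt ℝ (gradientField Ω u) x) (i : Fin n) (v : EuclideanSpace ℝ (Fin n)) :
    fderiv ℝ (fun y => graphGradient Ω u y i / graphW Ω u y) x v =
      fderiv ℝ (gradientField Ω u) x v i := by
  have h1 : (fun y => graphGradient Ω u y i / graphW Ω u y) =
      EuclideanSpace.proj (𝕜 := ℝ) i ∘ gradientField Ω u := by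
    funext y
    simp [gradientField, div_eq_inv_mul]
  rw [h1, ((EuclideanSpace.proj (𝕜 := ℝ) i).hasFDerivAt.comp x hV.hasFDerivAt).fderiv]
  rfl

/-- The elementary inequality relating flux, mean curvature and its reciprocal. -/
lemma sub_mul_sq_le {h p : ℝ} (hh : 0 < h) : p - h * p ^ 2 ≤ 1 / h - |p| := by
  have h1 : 1 / h - 2 * |p| + h * p ^ 2 = (1 - h * |p|) ^ 2 / h := by
    rw [← sq_abs p]
    field_simp
    ring
  have h2 : 0 ≤ (1 - h * |p|) ^ 2 / h := by positivity
  have := le_abs_self p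
  linarith

end IntegralIdentity
end SpacelikeGraph

/-! ### The three estimates -/

open SpacelikeGraph

theorem theorem5p4 (n : ℕ) (hn : 2 ≤ n)
    (Ω : Set (EuclideanSpace ℝ (Fin n))) (hΩopen : IsOpen Ω) (hΩconn : IsConnected Ω)
    (hΩbdd : Bornology.IsBounded Ω) (hΩsmooth : HasSmoothBoundary Ω)
    (u : EuclideanSpace ℝ (Fin n) → ℝ) (c : ℝ)
    (hu : ContDiffOn ℝ ∞ u (closure Ω))
    -- the graph is space-like up to its boundary
    (hspace : ∀ x ∈ closure Ω, ‖graphGradient Ω u x‖ < 1)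
    -- the boundary of the graph lies in the hyperplane at height `c`
    (hbdry : ∀ x ∈ frontier Ω, u x = c)
    -- the mean curvature is constant, normalised to be `n`
    (hcmc : ∀ x ∈ Ω, graphMeanCurvature Ω u x = n)
    (Hlow : ℝ) (hHlow : 0 < Hlow) (hH : ∀ x ∈ frontier Ω, Hlow ≤ boundaryMeanCurvature Ω x) :
    -- the equation `div (Du / w) = n`
    (∀ x ∈ Ω, ∑ i : Fin n,
      fderiv ℝ (fun y => graphGradient Ω u y i / graphW Ω u y) x (EuclideanSpace.single i 1) = n) ∧
    -- all the quantities in the estimates are well defined and finite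
    IsFiniteMeasure (surfaceMeasure Ω) ∧
    MemLp (traceFreeNorm Ω u) 2 (volume.restrict Ω) ∧
    Integrable (fun x => 1 / boundaryMeanCurvature Ω x) (surfaceMeasure Ω) ∧
    n * volume.real Ω ≤ ∫ x, 1 / boundaryMeanCurvature Ω x ∂(surfaceMeasure Ω) ∧
    MemLp (fun x => 1 / boundaryMeanCurvature Ω x - √(angleFunction Ω u x ^ 2 - 1)) 1
      (surfaceMeasure Ω) ∧
    MemLp (fun x => referenceCurvature Ω - boundaryMeanCurvature Ω x) ⊤ (surfaceMeasure Ω) ∧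
    -- (a)
    lpNorm (traceFreeNorm Ω u) 2 (volume.restrict Ω) ≤
      √(((n : ℝ) - 1) *
        ((∫ x, 1 / boundaryMeanCurvature Ω x ∂(surfaceMeasure Ω)) - n * volume.real Ω)) ∧
    -- (b)
    lpNorm (traceFreeNorm Ω u) 2 (volume.restrict Ω) ≤
      √((n : ℝ) - 1) *
        √(lpNorm (fun x => 1 / boundaryMeanCurvature Ω x - √(angleFunction Ω u x ^ 2 - 1)) 1
          (surfaceMeasure Ω)) ∧
    -- (c)
    lpNorm (traceFreeNorm Ω u) 2 (volume.restrict Ω) ≤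
      √(n * ((n : ℝ) - 1) * volume.real Ω / Hlow) *
        √(lpNorm (fun x => referenceCurvature Ω - boundaryMeanCurvature Ω x) ⊤
          (surfaceMeasure Ω)) := by
  obtain ⟨m, rfl⟩ : ∃ m, n = m + 1 := ⟨n - 1, by omega⟩
  have hm : m ≠ 0 := by omega
  have hm0 : (0 : ℝ) ≤ m := Nat.cast_nonneg m
  have hm1 : ((m + 1 : ℕ) : ℝ) - 1 = m := by push_cast; ring
  have hud := uniqueDiffOn_closure hΩopen hΩsmooth
  have hV := contDiffOn_gradientField hud hu hspace
  have hfin := isFiniteMeasure_surfaceMeasure hΩopen hΩbdd hΩsmooth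
  have hmem := memLp_traceFreeNorm hΩopen hΩbdd hΩsmooth hu hspace hcmc
  have hpos : ∀ x ∈ frontier Ω, 0 < boundaryMeanCurvature Ω x := fun x hx => hHlow.trans_le (hH x hx)
  set σ := surfaceMeasure Ω with hσ
  set φ := normalFlux Ω u with hφdef
  have hint {f : EuclideanSpace ℝ (Fin (m + 1)) → ℝ} (hf : ContinuousOn f (frontier Ω)) :
      Integrable f σ := integrable_of_continuousOn_frontier hΩopen hΩbdd hΩsmooth hf
  have hHc := continuousOn_boundaryMeanCurvature hm hΩopen hΩsmooth
  have hφc : ContinuousOn φ (frontier Ω) := continuousOn_normalFlux hΩopen hΩsmooth hu hspace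
  have hinvc : ContinuousOn (fun x => 1 / boundaryMeanCurvature Ω x) (frontier Ω) :=
    continuousOn_const.div hHc fun x hx => (hpos x hx).ne'
  have hinvi := hint hinvc
  have hφi := hint hφc
  have hφ2i : Integrable (fun x => φ x ^ 2) σ := hint (hφc.pow 2)
  have hHφi : Integrable (fun x => boundaryMeanCurvature Ω x * φ x ^ 2) σ :=
    hint (hHc.mul (hφc.pow 2))
  have hangle : ∀ x ∈ frontier Ω, √(angleFunction Ω u x ^ 2 - 1) = |φ x| := fun x hx => by
    rw [sqrt_angleFunction (hspace x (frontier_subset_closure hx)),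
      gradientField_eq_normalFlux_smul hΩopen hΩsmooth hu hbdry hx, norm_smul,
      norm_outerNormal hΩopen hΩsmooth hx, mul_one, Real.norm_eq_abs]
  have hdiffc : ContinuousOn
      (fun x => 1 / boundaryMeanCurvature Ω x - √(angleFunction Ω u x ^ 2 - 1)) (frontier Ω) :=
    (hinvc.sub hφc.abs).congr fun x hx => by simp only [Pi.sub_apply, hangle x hx]
  have hdiffi := hint hdiffc
  have hflux : ∫ x, φ x ∂σ = (m + 1 : ℕ) * volume.real Ω :=
    integral_normalFlux hΩopen hΩbdd hΩsmooth hu hspace hcmc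
  have hid : ∫ x in Ω, traceFreeNorm Ω u x ^ 2 =
      m * ((∫ x, φ x ∂σ) - ∫ x, boundaryMeanCurvature Ω x * φ x ^ 2 ∂σ) :=
    integral_traceFreeNorm_sq hm hΩopen hΩbdd hΩsmooth hu hspace hbdry hcmc
  have hnorm := lpNorm_traceFreeNorm hΩopen hΩbdd hΩsmooth hu hspace hcmc
  set D := (∫ x, φ x ∂σ) - ∫ x, boundaryMeanCurvature Ω x * φ x ^ 2 ∂σ with hD
  have hDeq : D = ∫ x, (φ x - boundaryMeanCurvature Ω x * φ x ^ 2) ∂σ :=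
    (integral_sub hφi hHφi).symm
  -- The sign comes from the identity, `m * D` being an integral of squares. It gives both `∫
  -- 1/H_{∂Ω} ≥ n|Ω|` and the bound on `∫ φ²` used for (c).
  have hD0 : 0 ≤ D := by
    have h1 : 0 ≤ m * D := hid ▸ integral_nonneg fun x => sq_nonneg _
    exact nonneg_of_mul_nonneg_right h1 (by positivity)
  have hDle : D ≤ ∫ x, (1 / boundaryMeanCurvature Ω x - |φ x|) ∂σ := by
    rw [hDeq]
    exact integral_mono_ae (hφi.sub hHφi) (hinvi.sub hφi.abs)
      (ae_mem_frontier.mono fun x hx => sub_mul_sq_le (hpos x hx))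
  have hDa : D ≤ (∫ x, 1 / boundaryMeanCurvature Ω x ∂σ) - (m + 1 : ℕ) * volume.real Ω := by
    rw [← hflux, ← integral_sub hinvi hφi]
    exact hDle.trans (integral_mono (hinvi.sub hφi.abs) (hinvi.sub hφi) fun x =>
      sub_le_sub_left (le_abs_self _) _)
  have hDb : D ≤ ∫ x, ‖1 / boundaryMeanCurvature Ω x - √(angleFunction Ω u x ^ 2 - 1)‖ ∂σ := by
    refine hDle.trans (integral_mono_ae (hinvi.sub hφi.abs) hdiffi.norm
      (ae_mem_frontier.mono fun x hx => ?_))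
    simp only
    rw [hangle x hx]
    exact le_abs_self _
  have hmemtop : MemLp (fun x => referenceCurvature Ω - boundaryMeanCurvature Ω x) ⊤ σ := by
    have hc : ContinuousOn (fun x => referenceCurvature Ω - boundaryMeanCurvature Ω x)
        (frontier Ω) := continuousOn_const.sub hHc
    obtain ⟨C, hC⟩ := (isCompact_frontier hΩbdd).exists_bound_of_continuousOn hc
    exact memLp_top_of_bound (hint hc).aestronglyMeasurable C (ae_mem_frontier.mono hC)
  have hvol : 0 < volume.real Ω :=
    ENNReal.toReal_pos (hΩopen.measure_pos volume hΩconn.nonempty).ne' hΩbdd.measure_lt_top.ne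
  set N := lpNorm (fun x => referenceCurvature Ω - boundaryMeanCurvature Ω x) ⊤ σ with hN
  have hN0 : 0 ≤ N := lpNorm_nonneg
  -- `Hlow ∫ φ² ≤ ∫ H_{∂Ω} φ² ≤ ∫ φ`, the last step being `D ≥ 0`.
  have hφ2 : ∫ x, φ x ^ 2 ∂σ ≤ (m + 1 : ℕ) * volume.real Ω / Hlow := by
    rw [le_div_iff₀ hHlow, ← hflux, mul_comm, ← integral_const_mul]
    refine (integral_mono_ae (hφ2i.const_mul Hlow) hHφi (ae_mem_frontier.mono fun x hx =>
      mul_le_mul_of_nonneg_right (hH x hx) (sq_nonneg _))).trans ?_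
    linarith
  -- Cauchy–Schwarz `F² ≤ A ∫ φ²`, in view of `H₀ = A / F`. It is obtained by integrating `(φ - F /
  -- A)² ≥ 0`; that `A > 0` follows from the flux being positive.
  have href : (∫ x, φ x ∂σ) - referenceCurvature Ω * ∫ x, φ x ^ 2 ∂σ ≤ 0 := by
    set A := σ.real Set.univ with hA
    have hA0 : 0 < A := by
      refine lt_of_le_of_ne measureReal_nonneg fun h0 => ?_
      have hσ0 : σ = 0 := by
        rw [← Measure.measure_univ_eq_zero]
        exact (measureReal_eq_zero_iff (measure_ne_top _ _)).mp h0.symm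
      rw [hσ0, integral_zero_measure] at hflux
      have : 0 < ((m + 1 : ℕ) : ℝ) * volume.real Ω := by positivity
      linarith
    set F := ∫ x, φ x ∂σ with hF
    have hR : referenceCurvature Ω = A / F := by rw [referenceCurvature, hflux]
    have hF0 : 0 < F := by rw [hflux]; positivity
    have h1 : ∫ x, (2 * (F / A) * φ x - (F / A) ^ 2) ∂σ ≤ ∫ x, φ x ^ 2 ∂σ :=
      integral_mono ((hφi.const_mul _).sub (integrable_const _)) hφ2i fun x => by
        have := sq_nonneg (φ x - F / A)
        simp only
        linarith
    rw [integral_sub (hφi.const_mul _) (integrable_const _), integral_const_mul, integral_const,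
      smul_eq_mul, ← hF, ← hA] at h1
    have h2 : 2 * (F / A) * F - A * (F / A) ^ 2 = F ^ 2 / A := by field_simp; ring
    rw [h2] at h1
    have h3 : A / F * (F ^ 2 / A) ≤ A / F * ∫ x, φ x ^ 2 ∂σ :=
      mul_le_mul_of_nonneg_left h1 (by positivity)
    have h4 : A / F * (F ^ 2 / A) = F := by field_simp
    rw [hR]
    linarith
  -- Adding and subtracting `H₀ ∫ φ²` in `D` leaves a nonpositive term and `∫ (H₀ - H_{∂Ω}) φ²`.
  have hDc : D ≤ N * ((m + 1 : ℕ) * volume.real Ω / Hlow) := by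
    have h1 : referenceCurvature Ω * (∫ x, φ x ^ 2 ∂σ) -
        (∫ x, boundaryMeanCurvature Ω x * φ x ^ 2 ∂σ) ≤ N * ∫ x, φ x ^ 2 ∂σ := by
      rw [← integral_const_mul, ← integral_const_mul, ← integral_sub (hφ2i.const_mul _) hHφi]
      refine integral_mono_ae ((hφ2i.const_mul _).sub hHφi) (hφ2i.const_mul _) ?_
      filter_upwards [ae_le_lpNorm_exponent_top hmemtop] with x hx
      rw [← sub_mul]
      exact mul_le_mul_of_nonneg_right ((le_abs_self _).trans hx) (sq_nonneg _)
    have h2 := mul_le_mul_of_nonneg_left hφ2 hN0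
    linarith
  refine ⟨fun x hx => ?_, hfin, hmem, hinvi, by linarith, memLp_one_iff_integrable.mpr hdiffi,
    hmemtop, ?_, ?_, ?_⟩
  · rw [← trace_jacobian_eq_on_closure hΩopen hΩsmooth hu hspace hcmc x (subset_closure hx),
      trace_jacobian, fderivWithin_closure_eq hΩopen hx]
    exact Finset.sum_congr rfl fun i _ => fderiv_gradientField_apply
      ((hV.contDiffAt (closure_mem_nhds hΩopen hx)).differentiableAt (by simp)) i _
  · rw [hnorm, hid, hm1]
    exact Real.sqrt_le_sqrt (mul_le_mul_of_nonneg_left hDa hm0)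
  · rw [hnorm, hid, hm1, ← Real.sqrt_mul hm0,
      lpNorm_one_eq_integral_norm hdiffi.aestronglyMeasurable]
    exact Real.sqrt_le_sqrt (mul_le_mul_of_nonneg_left hDb hm0)
  · rw [hnorm, hid, hm1, ← Real.sqrt_mul (by positivity)]
    refine Real.sqrt_le_sqrt ((mul_le_mul_of_nonneg_left hDc hm0).trans_eq ?_)
    ring
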